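/- Let $S\subset\mathbb E^n$ be a $k$-dimensional real analytic submanifold, $d=n-k$, and let $T$ be a tubular neighborhood of $S$: for a continuous function $r>0$ on $S$, $T$ is the open set of points $x+v$ with $x\in S$, $v$ normal to $S$ at $x$ and $|v|<r(x)$, and $\pi:T\to S$, $x+v\mapsto x$, is well defined and real analytic. Let $X(s)$, $s=(s^1,\dots,s^k)\in U$, be a regular analytic parametrization of an open piece of $S$, put $e_\alpha=\partial_\alpha X$, let $(e_{\dot a})_{\dot a=1,\dots,d}$ be an analytic frame of the normal bundle over it (orthonormal or not), and use the coordinates $(s,q)\mapsto X(s)+q^{\dot a}e_{\dot a}(s)$ on $T$. Repeated indices are summed. Let $(g_{T,\mu\nu})$ be the Euclidean metric in the coordinates $u=(s,q)$, $(g_T^{\mu\nu})$ its inverse, $g_T=\det(g_{T,\mu\nu})$; let $g_{S,\alpha\beta}=\langle e_\alpha,e_\beta\rangle$; and let $\Delta_T,\Delta_S$ be the Beltrami-Laplace operators of these metrics. Let $\nabla_\mu=\partial_\mu+\frac14(\partial_\mu\log g_T)=g_T^{-1/4}\,\partial_\mu\, g_T^{1/4}$. Let $\gamma_{\dot a}=(\gamma^\beta{}_{\dot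 a\alpha})_{\beta,\alpha}$ be the $k\times k$ matrix of Weingarten coefficients: the tangential part of $\partial_\alpha e_{\dot a}$ is $\gamma^\beta{}_{\dot a\alpha}e_\beta$. Functions of $s$ are also regarded as functions of $(s,q)$. For $V\subset U$ open (also regarded as an open subset of $S$), let $\mathcal C_S(V)$ and $\mathcal C_T(V)$ be the real analytic functions on $V$ and on $\pi^{-1}(V)$, and let $\mathcal A(V)$ be the ring of operators $\sum_\beta a_\beta(s)\nabla^\beta$ (finite sums, $a_\beta\in\mathcal C_S(V)$) acting on $\mathcal C_T(V)$, i.e. the differential operators of $T$ whose coefficients, in standard form with respect to $\nabla_1,\dots,\nabla_n$, have been restricted to $S$. Let $i_S^*\Delta_T\in\mathcal A(V)$ be obtained from $\Delta_T$ by putting $q=0$ in the coefficients of its standard form; equivalently, $(i_S^*\Delta_T)f$ and $\Delta_Tf$ agree on $S$ for all $f\in\mathcal C_T(V)$. Put $$\overline{\mathcal S}_{S\to T}=\mathcal A/\mathcal A\,(i_S^*\Delta_T),\qquad \overline{\mathcal S}^{\parallel}_{S\to T}=\operatorname{coker}\Big(\eta:(\overline{\mathcal S}_{S\to T})^{d}\to\overline{\mathcal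 S}_{S\to T},\ (P_{\dot a})\mapsto\sum_{\dot a}P_{\dot a}\nabla_{\dot a}\Big).$$ Lemma. Let $$\Delta^{\parallel}_{S\to T}=\Delta_S-\tfrac14\, g_T^{\dot a\dot b}|_S\,\operatorname{tr}(\gamma_{\dot a})\operatorname{tr}(\gamma_{\dot b})+\tfrac12\, g_T^{\dot a\dot b}|_S\,\operatorname{tr}(\gamma_{\dot a}\gamma_{\dot b}).$$ For every open $V\subset U$ there is exactly one operator in $\mathcal A(V)$, again written $\Delta^\parallel_{S\to T}$, such that $(\Delta^{\parallel}_{S\to T}f)|_S=\Delta^{\parallel}_{S\to T}(f|_S)$ for all $f\in\mathcal C_T(V)$, and evaluation at the class of $1$ is a bijection $$\Gamma\big(V,\mathcal Hom_{\mathcal A}(\overline{\mathcal S}^{\parallel}_{S\to T},\mathcal C_T)\big)\;\cong\;\{\psi\in\mathcal C_T(V)\mid \nabla_{\dot a}\psi=0\ (\dot a=1,\dots,d),\ \Delta^{\parallel}_{S\to T}\psi=0\}.$$ Moreover $\psi\mapsto\psi|_S$ maps the right-hand side bijectively onto $\{\varphi\in\mathcal C_S(V)\mid\Delta^{\parallel}_{S\to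 T}\varphi=0\}$. -/

import Mathlib

open TopologicalSpace Set
open scoped Topology

noncomputable section

set_option linter.unusedSectionVars false

namespace SubSchrodinger

section Calculus

variable {ι : Type*} [Fintype ι] [DecidableEq ι]
variable {F : Type*} [NormedAddCommGroup F] [InnerProductSpace ℝ F]

/-- The partial derivative `∂_μ f` in the coordinates `u = (u^μ)`. -/
def pd {G : Type*} [NormedAddCommGroup G] [NormedSpace ℝ G]
    (f : (ι → ℝ) → G) (μ : ι) (u : ι → ℝ) : G :=
  fderiv ℝ f u (Pi.single μ 1)

/-- The metric `g_{μν} = ⟨∂_μ Φ, ∂_ν Φ⟩` induced by a parametrization `Φ` of a piece of a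
Euclidean space or of a submanifold of it. -/
def metric (Φ : (ι → ℝ) → F) (u : ι → ℝ) : Matrix ι ι ℝ :=
  Matrix.gram ℝ (fun μ => pd Φ μ u)

/-- The Beltrami-Laplace operator `g^{-1/2} ∂_μ (g^{1/2} g^{μν} ∂_ν f)` of the induced metric,
where `g = det (g_{μν})` and `(g^{μν})` is the inverse matrix of `(g_{μν})`. -/
def beltrami (Φ : (ι → ℝ) → F) (f : (ι → ℝ) → ℝ) (u : ι → ℝ) : ℝ :=
  (√(metric Φ u).det)⁻¹ *
    ∑ μ, pd (fun v => √(metric Φ v).det * ∑ ν, (metric Φ v)⁻¹ μ ν * pd f ν v) μ u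

/-- The space `C^ω(O)` of real analytic functions on the open set `O` of a coordinate space.
A function on `O` is represented by its extension by zero, so that two elements are equal
exactly when they agree on `O`. -/
@[ext]
structure AnalyticFn (O : Opens (ι → ℝ)) where
  toFun : (ι → ℝ) → ℝ
  analytic : AnalyticOnNhd ℝ toFun O
  zero_off : ∀ u ∉ O, toFun u = 0

namespace AnalyticFn

variable {O : Opens (ι → ℝ)}

instance : Zero (AnalyticFn O) := ⟨⟨0, analyticOnNhd_const, fun _ _ => rfl⟩⟩

instance : Add (AnalyticFn O) := ⟨fun f g => ⟨f.1 + g.1, f.2.add g.2, fun u hu => by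
  simp [f.zero_off u hu, g.zero_off u hu]⟩⟩

instance : Neg (AnalyticFn O) := ⟨fun f => ⟨-f.1, f.2.neg, fun u hu => by
  simp [f.zero_off u hu]⟩⟩

instance : Sub (AnalyticFn O) := ⟨fun f g => ⟨f.1 - g.1, f.2.sub g.2, fun u hu => by
  simp [f.zero_off u hu, g.zero_off u hu]⟩⟩

instance : SMul ℝ (AnalyticFn O) := ⟨fun c f => ⟨c • f.1,
  fun u hu => (analyticAt_const (v := c)).smul (f.2 u hu), fun u hu => by
  simp [f.zero_off u hu]⟩⟩

instance : SMul ℕ (AnalyticFn O) := ⟨fun c f => ⟨c • f.1, by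
  rw [← Nat.cast_smul_eq_nsmul ℝ]
  exact fun u hu => (analyticAt_const (v := (c : ℝ))).smul (f.2 u hu), fun u hu => by
  simp [f.zero_off u hu]⟩⟩

instance : SMul ℤ (AnalyticFn O) := ⟨fun c f => ⟨c • f.1, by
  rw [← Int.cast_smul_eq_zsmul ℝ]
  exact fun u hu => (analyticAt_const (v := (c : ℝ))).smul (f.2 u hu), fun u hu => by
  simp [f.zero_off u hu]⟩⟩

theorem toFun_injective : Function.Injective (toFun : AnalyticFn O → (ι → ℝ) → ℝ) :=
  fun _ _ h => AnalyticFn.ext h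

instance : AddCommGroup (AnalyticFn O) :=
  toFun_injective.addCommGroup _ rfl (fun _ _ => rfl) (fun _ => rfl) (fun _ _ => rfl)
    (fun _ _ => rfl) (fun _ _ => rfl)

instance : Module ℝ (AnalyticFn O) :=
  toFun_injective.module ℝ ⟨⟨toFun, rfl⟩, fun _ _ => rfl⟩ fun _ _ => rfl

end AnalyticFn

theorem analyticOnNhd_indicator (O : Opens (ι → ℝ)) {f : (ι → ℝ) → ℝ}
    (hf : AnalyticOnNhd ℝ f O) : AnalyticOnNhd ℝ ((O : Set (ι → ℝ)).indicator f) O := by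
  intro u hu
  refine (hf u hu).congr ?_
  filter_upwards [O.isOpen.mem_nhds hu] with v hv
  exact (indicator_of_mem hv f).symm

/-- The element of `C^ω(O)` given by a function that is analytic on `O`. -/
def AnalyticFn.of (O : Opens (ι → ℝ)) (f : (ι → ℝ) → ℝ) (hf : AnalyticOnNhd ℝ f O) :
    AnalyticFn O :=
  ⟨(O : Set (ι → ℝ)).indicator f, analyticOnNhd_indicator O hf,
    fun _ hu => indicator_of_notMem hu f⟩

theorem AnalyticFn.of_apply {O : Opens (ι → ℝ)} {f : (ι → ℝ) → ℝ}
    (hf : AnalyticOnNhd ℝ f O) {u : ι → ℝ} (hu : u ∈ O) : (AnalyticFn.of O f hf).1 u = f u :=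
  indicator_of_mem (s := (O : Set (ι → ℝ))) hu f

theorem AnalyticFn.ext' {O : Opens (ι → ℝ)} {f g : AnalyticFn O}
    (h : ∀ u ∈ O, f.1 u = g.1 u) : f = g := by
  apply AnalyticFn.ext
  funext u
  by_cases hu : u ∈ O
  · exact h u hu
  · rw [f.zero_off u hu, g.zero_off u hu]

/-- Restriction of analytic functions to a smaller open set. -/
def restrictFn {O O' : Opens (ι → ℝ)} (h : O' ≤ O) (f : AnalyticFn O) :
    AnalyticFn O' :=
  AnalyticFn.of O' f.1 (f.analytic.mono h)

theorem analyticOnNhd_pd {G : Type*} [NormedAddCommGroup G] [NormedSpace ℝ G] [CompleteSpace G]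
    {f : (ι → ℝ) → G} {s : Set (ι → ℝ)}
    (hf : AnalyticOnNhd ℝ f s) (μ : ι) : AnalyticOnNhd ℝ (pd f μ) s := by
  intro u hu
  exact ((ContinuousLinearMap.apply ℝ G (Pi.single μ (1 : ℝ) : ι → ℝ)).analyticAt _).comp
    (hf.fderiv u hu)

theorem analyticOnNhd_mul_fn {O : Opens (ι → ℝ)} {a : (ι → ℝ) → ℝ} (ha : AnalyticOnNhd ℝ a O)
    (f : AnalyticFn O) : AnalyticOnNhd ℝ (fun u => a u * f.1 u) O :=
  ha.mul f.analytic

/-- Multiplication by an analytic function, as an operator on `C^ω(O)`. -/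
def mulOp (O : Opens (ι → ℝ)) (a : (ι → ℝ) → ℝ) (ha : AnalyticOnNhd ℝ a O) :
    Module.End ℝ (AnalyticFn O) where
  toFun f := AnalyticFn.of O (fun u => a u * f.1 u) (analyticOnNhd_mul_fn ha f)
  map_add' f g := AnalyticFn.ext' fun u hu =>
    (AnalyticFn.of_apply (analyticOnNhd_mul_fn ha (f + g)) hu).trans <|
      (mul_add (a u) (f.1 u) (g.1 u)).trans <| congrArg₂ (· + ·)
        (AnalyticFn.of_apply (analyticOnNhd_mul_fn ha f) hu).symm
        (AnalyticFn.of_apply (analyticOnNhd_mul_fn ha g) hu).symm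
  map_smul' c f := AnalyticFn.ext' fun u hu =>
    (AnalyticFn.of_apply (analyticOnNhd_mul_fn ha (c • f)) hu).trans <|
      (mul_left_comm (a u) c (f.1 u)).trans <| congrArg (c * ·)
        (AnalyticFn.of_apply (analyticOnNhd_mul_fn ha f) hu).symm

theorem mulOp_apply {O : Opens (ι → ℝ)} {a : (ι → ℝ) → ℝ} (ha : AnalyticOnNhd ℝ a O)
    (f : AnalyticFn O) {u : ι → ℝ} (hu : u ∈ O) : (mulOp O a ha f).1 u = a u * f.1 u :=
  AnalyticFn.of_apply (analyticOnNhd_mul_fn ha f) hu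

theorem pd_add {f g : (ι → ℝ) → ℝ} {u : ι → ℝ} (hf : AnalyticAt ℝ f u) (hg : AnalyticAt ℝ g u)
    (μ : ι) : pd (f + g) μ u = pd f μ u + pd g μ u := by
  rw [pd, fderiv_add hf.differentiableAt hg.differentiableAt]
  rfl

theorem pd_const_smul {f : (ι → ℝ) → ℝ} {u : ι → ℝ} (hf : AnalyticAt ℝ f u) (r : ℝ)
    (μ : ι) : pd (r • f) μ u = r * pd f μ u := by
  rw [pd, fderiv_const_smul hf.differentiableAt]
  rfl

/-- The derivation `∂_μ`, as an operator on `C^ω(O)`. -/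
def pdOp (O : Opens (ι → ℝ)) (μ : ι) : Module.End ℝ (AnalyticFn O) where
  toFun f := AnalyticFn.of O (pd f.1 μ) (analyticOnNhd_pd f.analytic μ)
  map_add' f g := AnalyticFn.ext' fun u hu =>
    (AnalyticFn.of_apply (analyticOnNhd_pd (f + g).analytic μ) hu).trans <|
      (pd_add (f.analytic u hu) (g.analytic u hu) μ).trans <| congrArg₂ (· + ·)
        (AnalyticFn.of_apply (analyticOnNhd_pd f.analytic μ) hu).symm
        (AnalyticFn.of_apply (analyticOnNhd_pd g.analytic μ) hu).symm
  map_smul' c f := AnalyticFn.ext' fun u hu =>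
    (AnalyticFn.of_apply (analyticOnNhd_pd (c • f).analytic μ) hu).trans <|
      (pd_const_smul (f.analytic u hu) c μ).trans <| congrArg (c * ·)
        (AnalyticFn.of_apply (analyticOnNhd_pd f.analytic μ) hu).symm

theorem pdOp_apply {O : Opens (ι → ℝ)} (μ : ι) (f : AnalyticFn O) {u : ι → ℝ} (hu : u ∈ O) :
    (pdOp O μ f).1 u = pd f.1 μ u :=
  AnalyticFn.of_apply (analyticOnNhd_pd f.analytic μ) hu

theorem analyticOnNhd_quarter_pd {O : Opens (ι → ℝ)} {w : (ι → ℝ) → ℝ}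
    (hw : AnalyticOnNhd ℝ w O) (μ : ι) : AnalyticOnNhd ℝ (fun u => 1 / 4 * pd w μ u) O :=
  analyticOnNhd_const.mul (analyticOnNhd_pd hw μ)

/-- The operator `∂_μ + (1/4) (∂_μ w)` on `C^ω(O)`. For `w = log g` with `g` the determinant of
the metric this is the anti-self-adjoint connection `∇_μ = g^{-1/4} ∂_μ g^{1/4}`. -/
def nablaOp (O : Opens (ι → ℝ)) (w : (ι → ℝ) → ℝ) (hw : AnalyticOnNhd ℝ w O) (μ : ι) :
    Module.End ℝ (AnalyticFn O) :=
  pdOp O μ + mulOp O (fun u => 1 / 4 * pd w μ u) (analyticOnNhd_quarter_pd hw μ)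

theorem nablaOp_apply {O : Opens (ι → ℝ)} {w : (ι → ℝ) → ℝ} (hw : AnalyticOnNhd ℝ w O) (μ : ι)
    (f : AnalyticFn O) {u : ι → ℝ} (hu : u ∈ O) :
    (nablaOp O w hw μ f).1 u = pd f.1 μ u + 1 / 4 * pd w μ u * f.1 u := by
  rw [← pdOp_apply μ f hu, ← mulOp_apply (analyticOnNhd_quarter_pd hw μ) f hu]
  rfl

theorem pd_congr {G : Type*} [NormedAddCommGroup G] [NormedSpace ℝ G]
    {O : Opens (ι → ℝ)} {f g : (ι → ℝ) → G} (h : ∀ u ∈ O, f u = g u) (μ : ι)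
    {u : ι → ℝ} (hu : u ∈ O) : pd f μ u = pd g μ u := by
  have : f =ᶠ[𝓝 u] g := by
    filter_upwards [O.isOpen.mem_nhds hu] with v hv using h v hv
  rw [pd, this.fderiv_eq, pd]

theorem pd_mul' {f g : (ι → ℝ) → ℝ} {u : ι → ℝ} (hf : AnalyticAt ℝ f u) (hg : AnalyticAt ℝ g u)
    (μ : ι) : pd (fun v => f v * g v) μ u = f u * pd g μ u + g u * pd f μ u := by
  rw [pd, fderiv_fun_mul hf.differentiableAt hg.differentiableAt]
  simp [pd]

theorem pd_comm {f : (ι → ℝ) → ℝ} {u : ι → ℝ} (hf : AnalyticAt ℝ f u) (μ ν : ι) :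
    pd (pd f ν) μ u = pd (pd f μ) ν u := by
  have key : ∀ μ ν : ι, pd (pd f ν) μ u
      = fderiv ℝ (fderiv ℝ f) u (Pi.single μ 1) (Pi.single ν 1) := by
    intro μ ν
    have h : pd f ν = fun v => fderiv ℝ f v (Pi.single ν 1) := rfl
    rw [h, pd, fderiv_clm_apply hf.fderiv.differentiableAt (differentiableAt_const _)]
    simp
  rw [key, key]
  have hs : IsSymmSndFDerivAt ℝ f u :=
    (hf.contDiffAt (n := ⊤)).isSymmSndFDerivAt (by simp)
  exact hs _ _

theorem nablaOp_comm {O : Opens (ι → ℝ)} {w : (ι → ℝ) → ℝ} (hw : AnalyticOnNhd ℝ w O)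
    (μ ν : ι) : Commute (nablaOp O w hw μ) (nablaOp O w hw ν) := by
  refine LinearMap.ext fun f => AnalyticFn.ext' fun u hu => ?_
  have e : ∀ μ ν : ι, ((nablaOp O w hw μ * nablaOp O w hw ν) f).1 u
      = pd (pd f.1 ν) μ u + 1 / 4 * (pd w ν u * pd f.1 μ u + f.1 u * pd (pd w ν) μ u)
        + 1 / 4 * pd w μ u * (pd f.1 ν u + 1 / 4 * pd w ν u * f.1 u) := by
    intro μ ν
    have hf := f.analytic u hu
    have hf' := analyticOnNhd_pd f.analytic ν u hu
    have hw' := analyticOnNhd_pd hw ν u hu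
    have hc : AnalyticAt ℝ (fun v => 1 / 4 * pd w ν v) u := analyticAt_const.mul hw'
    rw [Module.End.mul_apply, nablaOp_apply hw μ _ hu, nablaOp_apply hw ν _ hu,
      pd_congr (fun v hv => nablaOp_apply hw ν f hv) μ hu,
      show (fun v => pd f.1 ν v + 1 / 4 * pd w ν v * f.1 v)
        = pd f.1 ν + fun v => 1 / 4 * pd w ν v * f.1 v from rfl, pd_add (g := fun v => 1 / 4 * pd w ν v * f.1 v) hf' (hc.mul hf),
      pd_mul' (f := fun v => 1 / 4 * pd w ν v) (g := f.1) hc hf,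
      pd_mul' (f := fun _ => 1 / 4) (g := pd w ν) analyticAt_const hw']
    have : pd (fun _ : ι → ℝ => (1 / 4 : ℝ)) μ u = 0 := by simp [pd]
    rw [this]
    ring
  rw [e, e, pd_comm (f.analytic u hu) μ ν, pd_comm (hw u hu) μ ν]
  ring

theorem nablaOp_mulOp_comm {O : Opens (ι → ℝ)} {w a : (ι → ℝ) → ℝ}
    (hw : AnalyticOnNhd ℝ w O) (ha : AnalyticOnNhd ℝ a O) (μ : ι)
    (h : ∀ u ∈ O, pd a μ u = 0) : Commute (mulOp O a ha) (nablaOp O w hw μ) := by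
  refine LinearMap.ext fun f => AnalyticFn.ext' fun u hu => ?_
  have hm : ∀ v ∈ O, ∀ f : AnalyticFn O, (mulOp O a ha f).1 v = a v * f.1 v :=
    fun v hv f => mulOp_apply ha f hv
  rw [Module.End.mul_apply, Module.End.mul_apply, hm u hu, nablaOp_apply hw μ _ hu,
    nablaOp_apply hw μ _ hu, hm u hu, pd_congr (fun v hv => hm v hv f) μ hu,
    pd_mul' (ha u hu) (f.analytic u hu), h u hu]
  ring

theorem analyticOnNhd_log_det_metric [CompleteSpace F] {Φ : (ι → ℝ) → F} {s : Set (ι → ℝ)}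
    (hΦ : AnalyticOnNhd ℝ Φ s) (hi : ∀ u ∈ s, LinearIndependent ℝ (fun μ => pd Φ μ u)) :
    AnalyticOnNhd ℝ (fun u => Real.log (metric Φ u).det) s := by
  intro u hu
  have hpos : 0 < (metric Φ u).det := (Matrix.posDef_gram_of_linearIndependent (hi u hu)).det_pos
  refine ContDiffAt.analyticAt (ContDiffAt.log ?_ hpos.ne')
  simp only [Matrix.det_apply]
  refine ContDiffAt.sum fun σ _ => ContDiffAt.const_smul _ (contDiffAt_prod fun i _ => ?_)
  exact ContDiffAt.inner ℝ (analyticOnNhd_pd hΦ _ u hu).contDiffAt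
    (analyticOnNhd_pd hΦ _ u hu).contDiffAt

end Calculus

section Geometry

/-- Euclidean space `𝔼^n`. -/
abbrev Euc (n : ℕ) := EuclideanSpace ℝ (Fin n)

/-- The vectors tangent to the set `S` at `x`: velocities of curves in `S` through `x`. -/
def tangentVectors {n : ℕ} (S : Set (Euc n)) (x : Euc n) : Set (Euc n) :=
  {w | ∃ γ : ℝ → Euc n, γ 0 = x ∧ (∀ᶠ t in 𝓝 0, γ t ∈ S) ∧ HasDerivAt γ w 0}

/-- The normal space of `S` at `x`. -/
def normalSpace {n : ℕ} (S : Set (Euc n)) (x : Euc n) : Submodule ℝ (Euc n) :=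
  (Submodule.span ℝ (tangentVectors S x))ᗮ

/-- `X` is a regular real analytic parametrization, with parameters in the open set
`U ⊆ ℝ^k`, of a relatively open piece of `S`. -/
structure IsAnalyticParam {n k : ℕ} (S : Set (Euc n)) (U : Opens (Fin k → ℝ))
    (X : (Fin k → ℝ) → Euc n) : Prop where
  analytic : AnalyticOnNhd ℝ X U
  immersion : ∀ s ∈ U, Function.Injective (fderiv ℝ X s)
  embedding : Topology.IsEmbedding (fun s : U => X s)
  isOpen_image : ∃ O : Set (Euc n), IsOpen O ∧ X '' (U : Set (Fin k → ℝ)) = S ∩ O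

/-- A `k`-dimensional real analytic submanifold `S` of `𝔼^n`, `n = k + d`, together with a tubular
neighborhood `T` of it: `T` consists of the points `x + v` with `x ∈ S` and `v` a normal vector at
`x` of length less than `r x`, and sending `x + v` to `x` is a well-defined real analytic
projection `π` of `T` onto `S`. -/
structure TubularNeighborhood (k d : ℕ) where
  S : Set (Euc (k + d))
  submanifold : ∀ p ∈ S, ∃ (U : Opens (Fin k → ℝ)) (X : (Fin k → ℝ) → Euc (k + d)),
    IsAnalyticParam S U X ∧ p ∈ X '' (U : Set (Fin k → ℝ))
  r : Euc (k + d) → ℝ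
  r_pos : ∀ x ∈ S, 0 < r x
  r_continuous : ContinuousOn r S
  T : Set (Euc (k + d))
  T_eq : T = {y | ∃ x ∈ S, ∃ v ∈ normalSpace S x, ‖v‖ < r x ∧ y = x + v}
  isOpen_T : IsOpen T
  π : Euc (k + d) → Euc (k + d)
  π_eq : ∀ x ∈ S, ∀ v ∈ normalSpace S x, ‖v‖ < r x → π (x + v) = x
  π_analytic : AnalyticOnNhd ℝ π T

/-- A local chart of the tubular neighborhood: a parametrization `X` of an open piece of `S` by
local coordinates `s = (s^α)`, and a real analytic frame `(e_a)` of the normal bundle over it,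
which defines the normal coordinates `q = (q^a)`. The coordinates of `T` are `u = (s, q)`, indexed
by `Fin k ⊕ Fin d`. -/
structure Chart {k d : ℕ} (N : TubularNeighborhood k d) where
  U : Opens (Fin k → ℝ)
  X : (Fin k → ℝ) → Euc (k + d)
  param : IsAnalyticParam N.S U X
  e : Fin d → (Fin k → ℝ) → Euc (k + d)
  e_analytic : ∀ a, AnalyticOnNhd ℝ (e a) U
  e_normal : ∀ a, ∀ s ∈ U, e a s ∈ normalSpace N.S (X s)
  e_indep : ∀ s ∈ U, LinearIndependent ℝ (fun a => e a s)

namespace Chart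

variable {k d : ℕ} {N : TubularNeighborhood k d} (c : Chart N)

/-- The coordinates `s` of the foot point of the point with coordinates `u = (s, q)`. -/
def foot (u : Fin k ⊕ Fin d → ℝ) : Fin k → ℝ := fun α => u (Sum.inl α)

/-- The coordinates `(s, 0)` of the point of `S` with coordinates `s`. -/
def zeroSec (s : Fin k → ℝ) : Fin k ⊕ Fin d → ℝ := Sum.elim s 0

/-- The normal vector `q^a e_a(s)` of the point with coordinates `(s, q)`. -/
def normalVec (u : Fin k ⊕ Fin d → ℝ) : Euc (k + d) := ∑ a, u (Sum.inr a) • c.e a (foot u)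

/-- The point `X(s) + q^a e_a(s)` of `𝔼^n` with coordinates `(s, q)`. -/
def tubeMap (u : Fin k ⊕ Fin d → ℝ) : Euc (k + d) := c.X (foot u) + c.normalVec u

theorem analyticAt_foot (u : Fin k ⊕ Fin d → ℝ) :
    AnalyticAt ℝ (foot : (Fin k ⊕ Fin d → ℝ) → Fin k → ℝ) u :=
  (ContinuousLinearMap.pi (R := ℝ) fun α : Fin k =>
    ContinuousLinearMap.proj (R := ℝ) (φ := fun _ : Fin k ⊕ Fin d => ℝ) (Sum.inl α)).analyticAt u

theorem analyticAt_normalVec {u : Fin k ⊕ Fin d → ℝ} (hu : foot u ∈ c.U) :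
    AnalyticAt ℝ c.normalVec u := by
  unfold normalVec
  refine Finset.analyticAt_fun_sum _ fun a _ => AnalyticAt.fun_smul ?_ ?_
  · exact (ContinuousLinearMap.proj (R := ℝ) (φ := fun _ : Fin k ⊕ Fin d => ℝ)
      (Sum.inr a)).analyticAt u
  · exact AnalyticAt.comp (g := c.e a) (c.e_analytic a _ hu) (analyticAt_foot u)

theorem analyticAt_tubeMap {u : Fin k ⊕ Fin d → ℝ} (hu : foot u ∈ c.U) :
    AnalyticAt ℝ c.tubeMap u :=
  (AnalyticAt.comp (g := c.X) (c.param.analytic _ hu) (analyticAt_foot u)).add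
    (c.analyticAt_normalVec hu)

theorem X_mem {s : Fin k → ℝ} (hs : s ∈ c.U) : c.X s ∈ N.S := by
  obtain ⟨O, -, hO⟩ := c.param.isOpen_image
  have : c.X s ∈ N.S ∩ O := hO ▸ mem_image_of_mem _ hs
  exact this.1

/-- The part `π⁻¹(V)` of the tubular neighborhood over an open set `V` of `S` contained in the
domain of the chart, in the coordinates `(s, q)`. -/
def tube (V : Set.Iic c.U) : Opens (Fin k ⊕ Fin d → ℝ) where
  carrier := {u | foot u ∈ V.1 ∧ ‖c.normalVec u‖ < N.r (c.X (foot u))}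
  is_open' := by
    rw [isOpen_iff_mem_nhds]
    rintro u ⟨hu, hlt⟩
    have hV : ∀ᶠ v in 𝓝 u, foot v ∈ V.1 :=
      (analyticAt_foot u).continuousAt.eventually (V.1.isOpen.mem_nhds hu)
    have h1 : ContinuousAt (fun v => ‖c.normalVec v‖) u :=
      (c.analyticAt_normalVec (V.2 hu)).continuousAt.norm
    have h2 : ContinuousAt (fun v => N.r (c.X (foot v))) u := by
      have hr : ContinuousWithinAt N.r N.S (c.X (foot u)) :=
        N.r_continuous _ (c.X_mem (V.2 hu))
      refine hr.tendsto.comp (tendsto_nhdsWithin_iff.2 ⟨?_, ?_⟩)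
      · exact (AnalyticAt.comp (g := c.X) (c.param.analytic _ (V.2 hu))
          (analyticAt_foot u)).continuousAt
      · filter_upwards [hV] with v hv using c.X_mem (V.2 hv)
    filter_upwards [hV, h1.eventually_lt h2 hlt] with v hv hv' using ⟨hv, hv'⟩

theorem tube_mono {V V' : Set.Iic c.U} (h : V' ≤ V) : c.tube V' ≤ c.tube V :=
  fun _ hu => ⟨h hu.1, hu.2⟩

theorem foot_mem {V : Set.Iic c.U} {u : Fin k ⊕ Fin d → ℝ} (hu : u ∈ c.tube V) :
    foot u ∈ V.1 := hu.1

theorem zeroSec_mem {V : Set.Iic c.U} {s : Fin k → ℝ} (hs : s ∈ V.1) :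
    zeroSec s ∈ c.tube V := by
  have h0 : foot (zeroSec s : Fin k ⊕ Fin d → ℝ) = s := rfl
  refine ⟨hs, ?_⟩
  have : c.normalVec (zeroSec s) = 0 := by simp [normalVec, zeroSec]
  rw [this, norm_zero, h0]
  exact N.r_pos _ (c.X_mem (V.2 hs))

theorem normalVec_mem {V : Set.Iic c.U} {u : Fin k ⊕ Fin d → ℝ} (hu : u ∈ c.tube V) :
    c.normalVec u ∈ normalSpace N.S (c.X (foot u)) :=
  Submodule.sum_mem _ fun a _ => Submodule.smul_mem _ _ (c.e_normal a _ (V.2 hu.1))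

theorem tubeMap_mem {V : Set.Iic c.U} {u : Fin k ⊕ Fin d → ℝ} (hu : u ∈ c.tube V) :
    c.tubeMap u ∈ N.T := by
  rw [N.T_eq]
  exact ⟨_, c.X_mem (V.2 hu.1), _, c.normalVec_mem hu, hu.2, rfl⟩

theorem tubeMap_analytic (V : Set.Iic c.U) : AnalyticOnNhd ℝ c.tubeMap (c.tube V) :=
  fun _ hu => c.analyticAt_tubeMap (V.2 hu.1)

theorem tubeMap_immersion {V : Set.Iic c.U} {u : Fin k ⊕ Fin d → ℝ} (hu : u ∈ c.tube V) :
    LinearIndependent ℝ (fun μ => pd c.tubeMap μ u) := by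
  have hU : foot u ∈ c.U := V.2 hu.1
  have hΦ := (c.analyticAt_tubeMap hU).differentiableAt
  rw [Fintype.linearIndependent_iff]
  intro b hb
  have hb0 : fderiv ℝ c.tubeMap u b = 0 := by
    rw [← hb]
    conv_lhs => rw [pi_eq_sum_univ' b]
    simp only [map_sum, map_smul, pd]
  let L : (Fin k ⊕ Fin d → ℝ) →L[ℝ] (Fin k → ℝ) := ContinuousLinearMap.pi fun α : Fin k =>
    ContinuousLinearMap.proj (R := ℝ) (φ := fun _ : Fin k ⊕ Fin d => ℝ) (Sum.inl α)
  have hX : DifferentiableAt ℝ c.X (foot u) := (c.param.analytic _ hU).differentiableAt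
  have hcomp : HasFDerivAt (fun v => c.X (foot v)) ((fderiv ℝ c.X (foot u)).comp L) u :=
    HasFDerivAt.comp (g := c.X) u hX.hasFDerivAt L.hasFDerivAt
  have hπ : HasFDerivAt (fun v => N.π (c.tubeMap v))
      ((fderiv ℝ N.π (c.tubeMap u)).comp (fderiv ℝ c.tubeMap u)) u :=
    HasFDerivAt.comp (g := N.π) u
      (N.π_analytic _ (c.tubeMap_mem hu)).differentiableAt.hasFDerivAt hΦ.hasFDerivAt
  have heq : (fun v => N.π (c.tubeMap v)) =ᶠ[𝓝 u] fun v => c.X (foot v) := by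
    filter_upwards [(c.tube V).isOpen.mem_nhds hu] with v hv
    exact N.π_eq _ (c.X_mem (V.2 hv.1)) _ (c.normalVec_mem hv) hv.2
  have hd := (hcomp.congr_of_eventuallyEq heq).unique hπ
  have hLb : L b = 0 := by
    apply c.param.immersion _ hU
    have := congrArg (fun A => A b) hd
    simpa [hb0] using this
  have hbl : ∀ α, b (Sum.inl α) = 0 := fun α => congrFun hLb α
  have hline : HasDerivAt (fun t : ℝ => c.tubeMap (u + t • b)) 0 0 := by
    have h1 : HasDerivAt (fun t : ℝ => u + t • b) b 0 := by
      simpa using ((hasDerivAt_id (0 : ℝ)).smul_const b).const_add u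
    have h2 : HasFDerivAt c.tubeMap (fderiv ℝ c.tubeMap u) (u + (0 : ℝ) • b) := by
      simpa using hΦ.hasFDerivAt
    have := h2.comp_hasDerivAt (0 : ℝ) h1
    rwa [hb0] at this
  have hfoot : ∀ t : ℝ, foot (u + t • b) = foot u := by
    intro t
    funext α
    simp [foot, hbl α]
  have haff : (fun t : ℝ => c.tubeMap (u + t • b))
      = fun t : ℝ => c.tubeMap u + t • ∑ a, b (Sum.inr a) • c.e a (foot u) := by
    funext t
    simp only [tubeMap, normalVec, hfoot, Pi.add_apply, Pi.smul_apply, smul_eq_mul, add_smul,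
      Finset.sum_add_distrib, Finset.smul_sum, smul_smul, add_assoc]
  have hline' : HasDerivAt (fun t : ℝ => c.tubeMap (u + t • b))
      (∑ a, b (Sum.inr a) • c.e a (foot u)) 0 := by
    rw [haff]
    simpa using ((hasDerivAt_id (0 : ℝ)).smul_const
      (∑ a, b (Sum.inr a) • c.e a (foot u))).const_add (c.tubeMap u)
  have hsum := hline'.unique hline
  have hbr := Fintype.linearIndependent_iff.1 (c.e_indep _ hU) _ hsum
  rintro (α | a)
  · exact hbl α
  · exact hbr a

/-- The connection `∇_μ = ∂_μ + (1/4) (∂_μ log g_T)` on `C^ω(π⁻¹(V))`, where `g_T` is the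
determinant of the metric of `T` in the coordinates `(s, q)`. -/
def nabla (V : Set.Iic c.U) (μ : Fin k ⊕ Fin d) : Module.End ℝ (AnalyticFn (c.tube V)) :=
  nablaOp (c.tube V) (fun u => Real.log (metric c.tubeMap u).det)
    (analyticOnNhd_log_det_metric (c.tubeMap_analytic V) fun _ hu => c.tubeMap_immersion hu) μ

theorem analyticOnNhd_base (V : Set.Iic c.U) (a : AnalyticFn V.1) :
    AnalyticOnNhd ℝ (fun u : Fin k ⊕ Fin d → ℝ => a.1 (foot u)) (c.tube V) :=
  fun u hu => AnalyticAt.comp (g := a.1) (a.analytic _ (c.foot_mem hu))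
    (analyticAt_foot u)

/-- Multiplication by the function `(s, q) ↦ a(s)` with `a ∈ C^ω(V)`. -/
def mulBase (V : Set.Iic c.U) (a : AnalyticFn V.1) : Module.End ℝ (AnalyticFn (c.tube V)) :=
  mulOp (c.tube V) (fun u => a.1 (foot u)) (c.analyticOnNhd_base V a)

/-- The ring `i_S^* 𝒟_T` of differential operators of `T` restricted to `S`, over the open set `V`
of `S`: the operators with a standard form `∑ a_β(s) ∇^β`, whose coefficients are functions on
`S`. They act on `C^ω(π⁻¹(V))`. -/
def ops (V : Set.Iic c.U) : Subalgebra ℝ (Module.End ℝ (AnalyticFn (c.tube V))) :=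
  Algebra.adjoin ℝ (range (c.mulBase V) ∪ range (c.nabla V))

/-- The connection `∇_a` in the normal direction `q^a`, as an element of `i_S^* 𝒟_T`. -/
def normalNabla (V : Set.Iic c.U) (a : Fin d) : c.ops V :=
  ⟨c.nabla V (Sum.inr a), Algebra.subset_adjoin (Or.inr ⟨_, rfl⟩)⟩

theorem pd_base {a : (Fin k → ℝ) → ℝ} {u : Fin k ⊕ Fin d → ℝ}
    (ha : AnalyticAt ℝ a (foot u)) (b : Fin d) :
    pd (fun v : Fin k ⊕ Fin d → ℝ => a (foot v)) (Sum.inr b) u = 0 := by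
  let L : (Fin k ⊕ Fin d → ℝ) →L[ℝ] (Fin k → ℝ) := ContinuousLinearMap.pi fun α : Fin k =>
    ContinuousLinearMap.proj (R := ℝ) (φ := fun _ : Fin k ⊕ Fin d => ℝ) (Sum.inl α)
  have h : HasFDerivAt (fun v => a (foot v)) ((fderiv ℝ a (foot u)).comp L) u :=
    HasFDerivAt.comp (g := a) u ha.differentiableAt.hasFDerivAt L.hasFDerivAt
  have hL : L (Pi.single (Sum.inr b) 1) = 0 := by
    funext α
    simp [L]
  rw [pd, h.fderiv, ContinuousLinearMap.comp_apply, hL, map_zero]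

theorem normalNabla_comm (V : Set.Iic c.U) (a : Fin d) (P : c.ops V) :
    P * c.normalNabla V a = c.normalNabla V a * P := by
  apply Subtype.ext
  change P.1 * c.nabla V (Sum.inr a) = c.nabla V (Sum.inr a) * P.1
  have hle : c.ops V ≤ Subalgebra.centralizer ℝ {c.nabla V (Sum.inr a)} := by
    refine Algebra.adjoin_le ?_
    rintro _ (⟨f, rfl⟩ | ⟨μ, rfl⟩)
    · refine Subalgebra.mem_centralizer_iff ℝ |>.2 ?_
      rintro _ rfl
      exact (nablaOp_mulOp_comm _ (c.analyticOnNhd_base V f) (Sum.inr a) fun u hu =>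
        pd_base (f.analytic _ (c.foot_mem hu)) a).symm
    · refine Subalgebra.mem_centralizer_iff ℝ |>.2 ?_
      rintro _ rfl
      exact nablaOp_comm _ _ _
  exact (Subalgebra.mem_centralizer_iff ℝ |>.1 (hle P.2) _ rfl).symm

/-- `Q = i_S^* Δ_T`: the operator `Q = ∑ a_β(s) ∇^β` is obtained from the standard form of the
Beltrami-Laplace operator `Δ_T` of `T` by putting `q = 0` in its coefficients. Equivalently,
`Q f` and `Δ_T f` agree on `S` for all `f`. -/
def IsRestrictedLaplacian (V : Set.Iic c.U) (Q : c.ops V) : Prop :=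
  ∀ f : AnalyticFn (c.tube V), ∀ s ∈ V.1, (Q.1 f).1 (zeroSec s) = beltrami c.tubeMap f.1 (zeroSec s)

/-- The left ideal `(i_S^* 𝒟_T) (i_S^* Δ_T)`. -/
def laplaceIdeal (V : Set.Iic c.U) : Submodule (c.ops V) (c.ops V) :=
  Submodule.span (c.ops V) {Q | c.IsRestrictedLaplacian V Q}

/-- The left module `𝒮_{S→T} = i_S^* 𝒟_T / (i_S^* 𝒟_T) (i_S^* Δ_T)`, the restriction to `S` of the
Schrödinger system of `T`. -/
def RestrictedSystem (V : Set.Iic c.U) := c.ops V ⧸ c.laplaceIdeal V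

instance (V : Set.Iic c.U) : AddCommGroup (c.RestrictedSystem V) :=
  inferInstanceAs (AddCommGroup (c.ops V ⧸ c.laplaceIdeal V))

instance (V : Set.Iic c.U) : Module (c.ops V) (c.RestrictedSystem V) :=
  inferInstanceAs (Module (c.ops V) (c.ops V ⧸ c.laplaceIdeal V))

/-- The class in `𝒮_{S→T}` of an operator. -/
def restrictedCls (V : Set.Iic c.U) : c.ops V →ₗ[c.ops V] c.RestrictedSystem V :=
  (c.laplaceIdeal V).mkQ

/-- Right multiplication by `∇_a` on `i_S^* 𝒟_T`. -/
def rightMul (V : Set.Iic c.U) (a : Fin d) : c.ops V →ₗ[c.ops V] c.ops V :=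
  LinearMap.toSpanSingleton (c.ops V) (c.ops V) (c.normalNabla V a)

/-- The endomorphism `η_a : P ↦ P ∇_a` of the restricted Schrödinger system. -/
def etaOne (V : Set.Iic c.U) (a : Fin d) : c.RestrictedSystem V →ₗ[c.ops V] c.RestrictedSystem V :=
  Submodule.mapQ (c.laplaceIdeal V) (c.laplaceIdeal V) (c.rightMul V a) <| by
    refine Submodule.span_le.2 fun Q hQ => ?_
    change Q * c.normalNabla V a ∈ c.laplaceIdeal V
    rw [c.normalNabla_comm]
    exact Submodule.smul_mem _ (c.normalNabla V a) (Submodule.subset_span hQ)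

/-- The morphism `η : (𝒮_{S→T})^d → 𝒮_{S→T}`, `(P_a) ↦ ∑ P_a ∇_a`. -/
def eta (V : Set.Iic c.U) : (Fin d → c.RestrictedSystem V) →ₗ[c.ops V] c.RestrictedSystem V :=
  ∑ a, (c.etaOne V a).comp (LinearMap.proj a)

/-- The module `𝒮^∥_{S→T}`, the cokernel of `η`. -/
def ParallelSystem (V : Set.Iic c.U) := c.RestrictedSystem V ⧸ LinearMap.range (c.eta V)

instance (V : Set.Iic c.U) : AddCommGroup (c.ParallelSystem V) :=
  inferInstanceAs (AddCommGroup (c.RestrictedSystem V ⧸ LinearMap.range (c.eta V)))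

instance (V : Set.Iic c.U) : Module (c.ops V) (c.ParallelSystem V) :=
  inferInstanceAs (Module (c.ops V) (c.RestrictedSystem V ⧸ LinearMap.range (c.eta V)))

/-- The class in `𝒮^∥_{S→T}` of an operator. -/
def cls (V : Set.Iic c.U) : c.ops V →ₗ[c.ops V] c.ParallelSystem V :=
  (LinearMap.range (c.eta V)).mkQ.comp (c.restrictedCls V)

/-- `P'` is the restriction to the smaller open set `V'` of the operator `P` over `V`. -/
def Restricts {V V' : Set.Iic c.U} (h : V' ≤ V) (P : c.ops V) (P' : c.ops V') : Prop :=
  ∀ f : AnalyticFn (c.tube V),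
    P'.1 (restrictFn (c.tube_mono h) f) = restrictFn (c.tube_mono h) (P.1 f)

/-- The sections over `V` of the sheaf `ℋom(𝒮^∥_{S→T}, C^ω_T)` of solutions: families of linear
maps over the rings `i_S^* 𝒟_T`, one for each open `W ⊆ V`, which are compatible with restriction
of operators and of functions. -/
structure Solution (V : Set.Iic c.U) where
  app : ∀ W : Set.Iic c.U, W ≤ V → (c.ParallelSystem W →ₗ[c.ops W] AnalyticFn (c.tube W))
  compat : ∀ (W W' : Set.Iic c.U) (hW : W ≤ V) (h : W' ≤ W) (P : c.ops W) (P' : c.ops W'),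
    c.Restricts h P P' →
      app W' (h.trans hW) (c.cls W' P') = restrictFn (c.tube_mono h) (app W hW (c.cls W P))

/-- The function represented by a solution: its value on the class of `1`. -/
def Solution.toFn {V : Set.Iic c.U} (φ : c.Solution V) : AnalyticFn (c.tube V) :=
  φ.app V le_rfl (c.cls V 1)

/-- The restriction `ψ|_S` of an analytic function on `π⁻¹(V)` to `V`. -/
def restrictS (V : Set.Iic c.U) (ψ : AnalyticFn (c.tube V)) : AnalyticFn V.1 :=
  AnalyticFn.of V.1 (fun s => ψ.1 (zeroSec s)) fun s hs => by
    refine AnalyticAt.comp (g := ψ.1) (ψ.analytic _ (c.zeroSec_mem hs)) ?_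
    rw [analyticAt_pi_iff]
    rintro (α | a)
    · exact (ContinuousLinearMap.proj (R := ℝ) (φ := fun _ : Fin k => ℝ) α).analyticAt s
    · exact analyticAt_const

/-- The Weingarten coefficients: `weingarten a s` is the matrix `(γ^β_{aα})`, with row index `β`
and column index `α`, in the tangential part `γ^β_{aα} e_β` of `∂_α e_a`, where `e_β = ∂_β X`. -/
def weingarten (a : Fin d) (s : Fin k → ℝ) : Matrix (Fin k) (Fin k) ℝ :=
  Matrix.of fun β α => ∑ δ, (metric c.X s)⁻¹ β δ * inner ℝ (pd c.X δ s) (pd (c.e a) α s)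

/-- The block `g_T^{ab}|_S` of the inverse matrix of the metric of `T`, at points of `S`. -/
def normalMetricInv (s : Fin k → ℝ) (a b : Fin d) : ℝ :=
  (metric c.tubeMap (zeroSec s))⁻¹ (Sum.inr a) (Sum.inr b)

/-- The operator `Δ^∥ = Δ_S - (1/4) g^{ab} tr γ_a tr γ_b + (1/2) g^{ab} tr (γ_a γ_b)` on `S`. -/
def deltaPar (φ : (Fin k → ℝ) → ℝ) (s : Fin k → ℝ) : ℝ :=
  beltrami c.X φ s +
    (-(1 / 4) * ∑ a, ∑ b, c.normalMetricInv s a b *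
        ((c.weingarten a s).trace * (c.weingarten b s).trace)
      + 1 / 2 * ∑ a, ∑ b, c.normalMetricInv s a b *
        (c.weingarten a s * c.weingarten b s).trace) * φ s

end Chart

end Geometry

end SubSchrodinger

end

/-!
Write `W = log g_T`. Since `∇_μ = e^{-W/4} ∂_μ e^{W/4}`, the normal derivatives `∇_a` commute with
all operators of `i_S^* 𝒟_T`, whose coefficients depend on `s` alone. Two facts carry the proof.

*Rigidity.* If a space of analytic functions on the tube is stable under the `∇_a` and all its
members vanish on `S`, then it is zero (`eq_zero_of_normalNabla_stable`): all normal derivatives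
of a member vanish on `S`, and a segment joins each point of the tube to its foot point.
Applied to the range of an operator, this says that an operator is determined by the restrictions
to `S` of its values (`op_ext`); applied to one function killed by the `∇_a`, it says that such a
function is determined by its values on `S`. Conversely each function on `S` extends, explicitly, to
one killed by the `∇_a` (`exists_normalNabla_extension`), and each differential operator on `S`
lifts to `i_S^* 𝒟_T` (`exists_lift`), because `∂_α` is the restriction of
`∇_α - (∂_α W)|_S / 4`. So the lift of `Δ^∥` exists and is unique, and restriction to `S` is a
bijection between the two solution spaces.

*The Laplacian on `S`.* One has `i_S^* Δ_T = Δ^∥ + g_T^{ab}|_S ∇_a ∇_b`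
(`beltrami_tubeMap_eq_deltaPar`). At `q = 0` the metric is block diagonal, with blocks the metric of
`S` and the Gram matrix of the normal frame. In `Δ_T` the first order tangential terms coming from
the determinant of the latter and from `∂_a g_T^{aβ}` cancel, both being the trace of the normal
connection. The potential comes from `g_T = det (1 + q^a γ_a)^2 · g_T|_{q=0}`
(`det_metric_tubeMap`), which gives `∂_a W = 2 tr γ_a` and `∂_a ∂_b W = -2 tr (γ_a γ_b)` on `S`.
Consequently the homomorphisms from `𝒮^∥` to functions, which are the functions killed by the
`∇_a` and by `i_S^* Δ_T`, are those killed by the `∇_a` and by `Δ^∥`.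
-/

set_option linter.unusedSectionVars false

namespace SubSchrodinger

/-! ### Partial derivatives and matrix calculus -/

section PartialDerivatives

variable {ι : Type*} [Fintype ι] [DecidableEq ι]

theorem pd_congr_nhds {G : Type*} [NormedAddCommGroup G] [NormedSpace ℝ G]
    {f g : (ι → ℝ) → G} {u : ι → ℝ} (h : f =ᶠ[𝓝 u] g) (μ : ι) : pd f μ u = pd g μ u := by
  rw [pd, h.fderiv_eq, pd]

theorem pd_const (r : ℝ) (μ : ι) (u : ι → ℝ) : pd (fun _ : ι → ℝ => r) μ u = 0 := by
  simp [pd]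

theorem pd_fun_add {f g : (ι → ℝ) → ℝ} {u : ι → ℝ} (hf : AnalyticAt ℝ f u)
    (hg : AnalyticAt ℝ g u) (μ : ι) :
    pd (fun v => f v + g v) μ u = pd f μ u + pd g μ u :=
  pd_add hf hg μ

theorem pd_const_mul {f : (ι → ℝ) → ℝ} {u : ι → ℝ} (hf : AnalyticAt ℝ f u) (r : ℝ) (μ : ι) :
    pd (fun v => r * f v) μ u = r * pd f μ u :=
  pd_const_smul hf r μ

theorem pd_sum {κ : Type*} (t : Finset κ) {f : κ → (ι → ℝ) → ℝ} {u : ι → ℝ}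
    (hf : ∀ i ∈ t, AnalyticAt ℝ (f i) u) (μ : ι) :
    pd (fun v => ∑ i ∈ t, f i v) μ u = ∑ i ∈ t, pd (f i) μ u := by
  rw [pd, fderiv_fun_sum fun i hi => (hf i hi).differentiableAt]
  simp [pd]

theorem pd_inner {F : Type*} [NormedAddCommGroup F] [InnerProductSpace ℝ F]
    {f g : (ι → ℝ) → F} {u : ι → ℝ} (hf : AnalyticAt ℝ f u) (hg : AnalyticAt ℝ g u) (μ : ι) :
    pd (fun v => inner ℝ (f v) (g v)) μ u
      = inner ℝ (f u) (pd g μ u) + inner ℝ (pd f μ u) (g u) :=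
  fderiv_inner_apply ℝ hf.differentiableAt hg.differentiableAt _

theorem analyticAt_inner {E F : Type*} [NormedAddCommGroup E] [NormedSpace ℝ E]
    [NormedAddCommGroup F] [InnerProductSpace ℝ F] [CompleteSpace F]
    {f g : E → F} {u : E} (hf : AnalyticAt ℝ f u) (hg : AnalyticAt ℝ g u) :
    AnalyticAt ℝ (fun v => (inner ℝ (f v) (g v) : ℝ)) u :=
  (ContDiffAt.inner ℝ hf.contDiffAt hg.contDiffAt).analyticAt

theorem pd_log {f : (ι → ℝ) → ℝ} {u : ι → ℝ} (hf : AnalyticAt ℝ f u) (h0 : f u ≠ 0) (μ : ι) :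
    pd (fun v => Real.log (f v)) μ u = (f u)⁻¹ * pd f μ u := by
  rw [pd, (hf.differentiableAt.hasFDerivAt.log h0).fderiv]
  simp [pd]

theorem pd_sqrt {f : (ι → ℝ) → ℝ} {u : ι → ℝ} (hf : AnalyticAt ℝ f u) (h0 : 0 < f u) (μ : ι) :
    pd (fun v => √(f v)) μ u = √(f u) * (1 / 2 * pd (fun v => Real.log (f v)) μ u) := by
  rw [pd_log hf h0.ne', pd, (hf.differentiableAt.hasFDerivAt.sqrt h0.ne').fderiv]
  have h1 : √(f u) ≠ 0 := (Real.sqrt_pos.2 h0).ne'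
  have h2 : √(f u) * √(f u) = f u := Real.mul_self_sqrt h0.le
  simp only [pd, FunLike.coe_smul, Pi.smul_apply, smul_eq_mul]
  rw [← h2]
  simp only [Real.sqrt_mul_self (Real.sqrt_nonneg (f u))]
  field_simp

theorem analyticAt_sqrt {E : Type*} [NormedAddCommGroup E] [NormedSpace ℝ E]
    {f : E → ℝ} {u : E} (hf : AnalyticAt ℝ f u) (h0 : 0 < f u) :
    AnalyticAt ℝ (fun v => √(f v)) u :=
  (hf.contDiffAt.sqrt h0.ne').analyticAt

theorem pd_exp {f : (ι → ℝ) → ℝ} {u : ι → ℝ} (hf : AnalyticAt ℝ f u) (μ : ι) :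
    pd (fun v => Real.exp (f v)) μ u = Real.exp (f u) * pd f μ u := by
  rw [pd, hf.differentiableAt.hasFDerivAt.exp.fderiv]
  simp [pd]

end PartialDerivatives

section MatrixCalculus

variable {E : Type*} [NormedAddCommGroup E] [NormedSpace ℝ E]
variable {m : Type*} [Fintype m] [DecidableEq m]

theorem analyticAt_det {A : E → Matrix m m ℝ} {u : E}
    (hA : ∀ i j, AnalyticAt ℝ (fun v => A v i j) u) : AnalyticAt ℝ (fun v => (A v).det) u := by
  simp only [Matrix.det_apply']
  exact Finset.analyticAt_fun_sum _ fun σ _ => analyticAt_const.mul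
    (Finset.analyticAt_fun_prod _ fun i _ => hA _ _)

theorem analyticAt_inv_apply {A : E → Matrix m m ℝ} {u : E}
    (hA : ∀ i j, AnalyticAt ℝ (fun v => A v i j) u) (h0 : (A u).det ≠ 0) (i j : m) :
    AnalyticAt ℝ (fun v => (A v)⁻¹ i j) u := by
  simp only [Matrix.inv_def, Matrix.smul_apply, Ring.inverse_eq_inv', smul_eq_mul,
    Matrix.adjugate_apply]
  refine ((analyticAt_det hA).inv h0).mul (analyticAt_det fun p q => ?_)
  by_cases hp : p = j
  · subst hp
    simpa using analyticAt_const
  · simpa [Matrix.updateRow_ne hp] using hA p q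

variable {ι : Type*} [Fintype ι] [DecidableEq ι]

/-- The entrywise partial derivative of a matrix valued function. -/
noncomputable def matPd {p q : Type*} (A : (ι → ℝ) → Matrix p q ℝ) (μ : ι) (u : ι → ℝ) :
    Matrix p q ℝ :=
  Matrix.of fun i j => pd (fun v => A v i j) μ u

theorem pd_inv_apply {A : (ι → ℝ) → Matrix m m ℝ} {u : ι → ℝ}
    (hA : ∀ i j, AnalyticAt ℝ (fun v => A v i j) u) (h0 : (A u).det ≠ 0) (μ : ι) (i j : m) :
    pd (fun v => (A v)⁻¹ i j) μ u = -((A u)⁻¹ * matPd A μ u * (A u)⁻¹) i j := by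
  have hB := analyticAt_inv_apply hA h0
  have hunit : ∀ᶠ v in 𝓝 u, IsUnit (A v).det := by
    filter_upwards [(analyticAt_det hA).continuousAt.eventually_ne h0] with v hv
      using isUnit_iff_ne_zero.2 hv
  have key : A u * matPd (fun v => (A v)⁻¹) μ u + matPd A μ u * (A u)⁻¹ = 0 := by
    ext p q
    have h : (fun v => ∑ l, A v p l * (A v)⁻¹ l q) =ᶠ[𝓝 u] fun _ => (1 : Matrix m m ℝ) p q := by
      filter_upwards [hunit] with v hv
      rw [← Matrix.mul_apply, Matrix.mul_nonsing_inv _ hv]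
    have h' := pd_congr_nhds h μ
    rw [pd_const, pd_sum (f := fun l v => A v p l * (A v)⁻¹ l q) _
      fun l _ => (hA p l).fun_mul (hB l q)] at h'
    rw [Matrix.add_apply, Matrix.mul_apply, Matrix.mul_apply, ← Finset.sum_add_distrib,
      Matrix.zero_apply, ← h']
    refine Finset.sum_congr rfl fun l _ => ?_
    rw [pd_mul' (hA p l) (hB l q)]
    simp only [matPd, Matrix.of_apply]
    ring
  have h1 : matPd (fun v => (A v)⁻¹) μ u = -((A u)⁻¹ * matPd A μ u * (A u)⁻¹) := by
    have := congrArg ((A u)⁻¹ * ·) (eq_neg_of_add_eq_zero_left key)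
    simpa only [← Matrix.mul_assoc, Matrix.nonsing_inv_mul _ hunit.self_of_nhds, Matrix.one_mul,
      Matrix.mul_neg] using this
  exact congrFun (congrFun h1 i) j

/-- Jacobi's formula. -/
theorem pd_det {A : (ι → ℝ) → Matrix m m ℝ} {u : ι → ℝ}
    (hA : ∀ i j, AnalyticAt ℝ (fun v => A v i j) u) (h0 : (A u).det ≠ 0) (μ : ι) :
    pd (fun v => (A v).det) μ u = (A u).det * ((A u)⁻¹ * matPd A μ u).trace := by
  have hprod : ∀ σ : Equiv.Perm m, pd (fun v => ∏ i, A v (σ i) i) μ u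
      = ∑ i, ∏ j, (A u).updateCol i (fun l => matPd A μ u l i) (σ j) j := by
    intro σ
    have h := (HasFDerivAt.finsetProd (u := Finset.univ) fun i _ =>
      (hA (σ i) i).differentiableAt.hasFDerivAt).fderiv
    rw [pd, h]
    simp only [sum_apply, FunLike.coe_smul, Pi.smul_apply, smul_eq_mul]
    refine Finset.sum_congr rfl fun i _ => ?_
    rw [← Finset.mul_prod_erase _ _ (Finset.mem_univ i), Matrix.updateCol_self, mul_comm]
    congr 1
    exact Finset.prod_congr rfl fun j hj => by
      rw [Matrix.updateCol_ne (Finset.ne_of_mem_erase hj)]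
  have hdet : pd (fun v => (A v).det) μ u
      = ∑ i, ((A u).updateCol i fun l => matPd A μ u l i).det := by
    simp only [Matrix.det_apply']
    rw [pd_sum (f := fun (σ : Equiv.Perm m) v => ((Equiv.Perm.sign σ : ℤ) : ℝ) * ∏ i, A v (σ i) i) _
      fun σ _ => analyticAt_const.fun_mul (Finset.analyticAt_fun_prod _ fun i _ => hA _ _),
      Finset.sum_comm]
    refine Finset.sum_congr rfl fun σ _ => ?_
    rw [pd_const_mul (Finset.analyticAt_fun_prod _ fun i _ => hA _ _), hprod, Finset.mul_sum]
  rw [hdet, Matrix.trace, Finset.mul_sum]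
  refine Finset.sum_congr rfl fun i _ => ?_
  rw [← Matrix.cramer_apply, Matrix.cramer_eq_adjugate_mulVec, Matrix.diag_apply, Matrix.mul_apply,
    Matrix.mulVec, dotProduct, Finset.mul_sum]
  refine Finset.sum_congr rfl fun j _ => ?_
  rw [Matrix.inv_def, Matrix.smul_apply, Ring.inverse_eq_inv', smul_eq_mul, ← mul_assoc,
    mul_inv_cancel_left₀ h0]

theorem pd_log_det {A : (ι → ℝ) → Matrix m m ℝ} {u : ι → ℝ}
    (hA : ∀ i j, AnalyticAt ℝ (fun v => A v i j) u) (h0 : (A u).det ≠ 0) (μ : ι) :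
    pd (fun v => Real.log (A v).det) μ u = ((A u)⁻¹ * matPd A μ u).trace := by
  rw [pd_log (analyticAt_det hA) h0, pd_det hA h0, inv_mul_cancel_left₀ h0]

end MatrixCalculus

/-! ### Normal derivatives and restriction to the submanifold -/

namespace Chart

variable {k d : ℕ}

theorem pd_comp_foot_inl {G : Type*} [NormedAddCommGroup G] [NormedSpace ℝ G]
    {a : (Fin k → ℝ) → G} {u : Fin k ⊕ Fin d → ℝ} (ha : AnalyticAt ℝ a (foot u)) (α : Fin k) :
    pd (fun v : Fin k ⊕ Fin d → ℝ => a (foot v)) (Sum.inl α) u = pd a α (foot u) := by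
  let L : (Fin k ⊕ Fin d → ℝ) →L[ℝ] (Fin k → ℝ) := ContinuousLinearMap.pi fun α : Fin k =>
    ContinuousLinearMap.proj (R := ℝ) (φ := fun _ : Fin k ⊕ Fin d => ℝ) (Sum.inl α)
  have h : HasFDerivAt (fun v => a (foot v)) ((fderiv ℝ a (foot u)).comp L) u :=
    HasFDerivAt.comp (g := a) u ha.differentiableAt.hasFDerivAt L.hasFDerivAt
  have hL : L (Pi.single (Sum.inl α) 1) = Pi.single α 1 := by
    funext β
    simp [L, Pi.single_apply]
  rw [pd, h.fderiv, ContinuousLinearMap.comp_apply, hL, pd]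

theorem pd_comp_foot_inr {G : Type*} [NormedAddCommGroup G] [NormedSpace ℝ G]
    {a : (Fin k → ℝ) → G} {u : Fin k ⊕ Fin d → ℝ} (ha : AnalyticAt ℝ a (foot u)) (b : Fin d) :
    pd (fun v : Fin k ⊕ Fin d → ℝ => a (foot v)) (Sum.inr b) u = 0 := by
  let L : (Fin k ⊕ Fin d → ℝ) →L[ℝ] (Fin k → ℝ) := ContinuousLinearMap.pi fun α : Fin k =>
    ContinuousLinearMap.proj (R := ℝ) (φ := fun _ : Fin k ⊕ Fin d => ℝ) (Sum.inl α)
  have h : HasFDerivAt (fun v => a (foot v)) ((fderiv ℝ a (foot u)).comp L) u :=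
    HasFDerivAt.comp (g := a) u ha.differentiableAt.hasFDerivAt L.hasFDerivAt
  have hL : L (Pi.single (Sum.inr b) 1) = 0 := by
    funext α
    simp [L]
  rw [pd, h.fderiv, ContinuousLinearMap.comp_apply, hL, map_zero]

theorem foot_zeroSec (s : Fin k → ℝ) : foot (zeroSec s : Fin k ⊕ Fin d → ℝ) = s := rfl

theorem analyticAt_zeroSec (s : Fin k → ℝ) :
    AnalyticAt ℝ (zeroSec : (Fin k → ℝ) → Fin k ⊕ Fin d → ℝ) s := by
  rw [analyticAt_pi_iff]
  rintro (α | a)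
  · exact (ContinuousLinearMap.proj (R := ℝ) (φ := fun _ : Fin k => ℝ) α).analyticAt s
  · exact analyticAt_const

theorem analyticAt_comp_zeroSec {G : Type*} [NormedAddCommGroup G] [NormedSpace ℝ G]
    {g : (Fin k ⊕ Fin d → ℝ) → G} {s : Fin k → ℝ} (hg : AnalyticAt ℝ g (zeroSec s)) :
    AnalyticAt ℝ (fun t => g (zeroSec t)) s :=
  AnalyticAt.comp (g := g) hg (analyticAt_zeroSec s)

theorem pd_comp_zeroSec {G : Type*} [NormedAddCommGroup G] [NormedSpace ℝ G]
    {g : (Fin k ⊕ Fin d → ℝ) → G} {s : Fin k → ℝ} (hg : AnalyticAt ℝ g (zeroSec s)) (α : Fin k) :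
    pd (fun t => g (zeroSec t)) α s = pd g (Sum.inl α) (zeroSec s) := by
  have h : HasFDerivAt (fun t => g (zeroSec t))
      ((fderiv ℝ g (zeroSec s)).comp (fderiv ℝ zeroSec s)) s :=
    HasFDerivAt.comp (g := g) s hg.differentiableAt.hasFDerivAt
      (analyticAt_zeroSec s).differentiableAt.hasFDerivAt
  let L : (Fin k → ℝ) →L[ℝ] (Fin k ⊕ Fin d → ℝ) := ContinuousLinearMap.pi fun μ =>
    Sum.elim (fun α => ContinuousLinearMap.proj (R := ℝ) (φ := fun _ : Fin k => ℝ) α)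
      (fun _ => 0) μ
  have hL0 : (zeroSec : (Fin k → ℝ) → Fin k ⊕ Fin d → ℝ) = L := by
    funext t μ
    cases μ <;> simp [L, zeroSec]
  have hL : L (Pi.single α 1) = Pi.single (Sum.inl α) 1 := by
    funext μ
    cases μ <;> simp [L, Pi.single_apply]
  rw [pd, h.fderiv, ContinuousLinearMap.comp_apply, hL0, L.fderiv, hL, pd]

variable {N : TubularNeighborhood k d} (c : Chart N)

/-- The logarithm `log g_T` of the determinant of the metric of `T` in the coordinates `(s, q)`. -/
noncomputable def logVol (u : Fin k ⊕ Fin d → ℝ) : ℝ := Real.log (metric c.tubeMap u).det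

theorem analyticOnNhd_logVol (V : Set.Iic c.U) : AnalyticOnNhd ℝ c.logVol (c.tube V) :=
  analyticOnNhd_log_det_metric (c.tubeMap_analytic V) fun _ hu => c.tubeMap_immersion hu

theorem nabla_apply {V : Set.Iic c.U} (μ : Fin k ⊕ Fin d) (f : AnalyticFn (c.tube V))
    {u : Fin k ⊕ Fin d → ℝ} (hu : u ∈ c.tube V) :
    (c.nabla V μ f).1 u = pd f.1 μ u + 1 / 4 * pd c.logVol μ u * f.1 u :=
  nablaOp_apply (c.analyticOnNhd_logVol V) μ f hu

/-- `∇_μ = g_T^{-1/4} ∂_μ g_T^{1/4}`. -/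
theorem pd_exp_mul {V : Set.Iic c.U} (μ : Fin k ⊕ Fin d) (f : AnalyticFn (c.tube V))
    {u : Fin k ⊕ Fin d → ℝ} (hu : u ∈ c.tube V) :
    pd (fun v => Real.exp (1 / 4 * c.logVol v) * f.1 v) μ u
      = Real.exp (1 / 4 * c.logVol u) * (c.nabla V μ f).1 u := by
  have hw := c.analyticOnNhd_logVol V u hu
  rw [pd_mul' (f := fun v => Real.exp (1 / 4 * c.logVol v))
      (analyticAt_const.fun_mul hw).rexp (f.analytic u hu),
    pd_exp (analyticAt_const.fun_mul hw), pd_const_mul hw, c.nabla_apply μ f hu]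
  ring

theorem restrictS_apply {V : Set.Iic c.U} (f : AnalyticFn (c.tube V)) {s : Fin k → ℝ}
    (hs : s ∈ V.1) : (c.restrictS V f).1 s = f.1 (zeroSec s) :=
  AnalyticFn.of_apply _ hs

/-- A family of functions that is stable under the normal derivatives `∇_a` and vanishes on `S`
consists of `0` alone: every normal derivative of a member vanishes on `S`, and each fibre of the
tube is joined to `S` by segments, along which the identity theorem applies. -/
theorem eq_zero_of_normalNabla_stable {V : Set.Iic c.U}
    (K : Submodule ℝ (AnalyticFn (c.tube V)))
    (hK : ∀ f ∈ K, ∀ a : Fin d, c.nabla V (Sum.inr a) f ∈ K)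
    (h0 : ∀ f ∈ K, ∀ s ∈ V.1, f.1 (zeroSec s) = 0) {f : AnalyticFn (c.tube V)} (hf : f ∈ K) :
    f = 0 := by
  refine AnalyticFn.ext' fun u hu => ?_
  change f.1 u = 0
  set q : Fin d → ℝ := fun a => u (Sum.inr a) with hq
  set b : Fin k ⊕ Fin d → ℝ := Sum.elim 0 q with hb
  let l : ℝ → Fin k ⊕ Fin d → ℝ := fun t => zeroSec (foot u) + t • b
  have hl0 : l 0 = zeroSec (foot u) := by simp [l]
  have hl1 : l 1 = u := by
    funext μ
    cases μ <;> simp [l, zeroSec, foot, hb, hq]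
  have hlan : ∀ t, AnalyticAt ℝ l t := fun t =>
    analyticAt_const.add (analyticAt_id.smul analyticAt_const)
  have hlder : ∀ t, HasDerivAt l b t := fun t => by
    have h := ((hasDerivAt_id t).smul_const b).const_add (zeroSec (foot u))
    rwa [one_smul] at h
  have hfoot : ∀ t, foot (l t) = foot u := fun t => by
    funext α
    simp [l, foot, zeroSec, hb]
  have hnv : ∀ t, c.normalVec (l t) = t • c.normalVec u := fun t => by
    simp only [normalVec, hfoot, Finset.smul_sum, smul_smul]
    refine Finset.sum_congr rfl fun a _ => ?_
    simp [l, zeroSec, hb, hq]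
  have hmem : ∀ t ∈ Icc (0 : ℝ) 1, l t ∈ c.tube V := fun t ht => by
    refine ⟨by rw [hfoot]; exact hu.1, ?_⟩
    rw [hnv, hfoot, norm_smul, Real.norm_of_nonneg ht.1]
    exact (mul_le_of_le_one_left (norm_nonneg _) ht.2).trans_lt hu.2
  let H : AnalyticFn (c.tube V) → (Fin k ⊕ Fin d → ℝ) → ℝ :=
    fun g v => Real.exp (1 / 4 * c.logVol v) * g.1 v
  have hH : ∀ g, ∀ v ∈ c.tube V, AnalyticAt ℝ (H g) v := fun g v hv =>
    (analyticAt_const.fun_mul (c.analyticOnNhd_logVol V v hv)).rexp.fun_mul (g.analytic v hv)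
  -- The derivative of `f` along the fixed vector `q^a ∂_a`, in the gauge of `∇`.
  let E : AnalyticFn (c.tube V) → AnalyticFn (c.tube V) :=
    fun g => ∑ a, q a • c.nabla V (Sum.inr a) g
  have hEK : ∀ g ∈ K, E g ∈ K := fun g hg =>
    Submodule.sum_mem _ fun a _ => Submodule.smul_mem _ _ (hK g hg a)
  have hsum : ∀ (g : AnalyticFn (c.tube V)) v, (E g).1 v
      = ∑ a, q a * (c.nabla V (Sum.inr a) g).1 v := by
    intro g v
    let ev : AnalyticFn (c.tube V) →ₗ[ℝ] ℝ :=
      { toFun := fun g => g.1 v, map_add' := fun _ _ => rfl, map_smul' := fun _ _ => rfl }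
    exact (map_sum ev _ _).trans (Finset.sum_congr rfl fun a _ => map_smul ev _ _)
  have hder : ∀ g t, l t ∈ c.tube V → deriv (fun t => H g (l t)) t = H (E g) (l t) := by
    intro g t ht
    have h1 : HasDerivAt (fun t => H g (l t)) (fderiv ℝ (H g) (l t) b) t :=
      (hH g _ ht).differentiableAt.hasFDerivAt.comp_hasDerivAt t (hlder t)
    have h2 : fderiv ℝ (H g) (l t) b = ∑ μ, b μ * pd (H g) μ (l t) := by
      conv_lhs => rw [pi_eq_sum_univ' b]
      simp [pd]
    rw [h1.deriv, h2, Fintype.sum_sum_type]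
    simp only [hb, Sum.elim_inl, Sum.elim_inr, Pi.zero_apply, zero_mul, Finset.sum_const_zero,
      zero_add]
    change _ = Real.exp _ * (E g).1 (l t)
    rw [hsum, Finset.mul_sum]
    refine Finset.sum_congr rfl fun a _ => ?_
    rw [c.pd_exp_mul (Sum.inr a) g ht]
    ring
  have hiter : ∀ n, ∀ g ∈ K, iteratedDeriv n (fun t => H g (l t)) 0 = 0 := by
    intro n
    induction n with
    | zero =>
      intro g hg
      simp only [iteratedDeriv_zero, hl0, H, h0 g hg _ hu.1, mul_zero]
    | succ n ih =>
      intro g hg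
      have hev : deriv (fun t => H g (l t)) =ᶠ[𝓝 0] fun t => H (E g) (l t) := by
        filter_upwards [(hlan 0).continuousAt.eventually
          ((c.tube V).isOpen.mem_nhds (hmem 0 (by simp)))] with t ht using hder g t ht
      rw [iteratedDeriv_succ', hev.iteratedDeriv_eq, ih _ (hEK g hg)]
  have han : AnalyticOnNhd ℝ (fun t => H f (l t)) (Icc 0 1) := fun t ht =>
    AnalyticAt.comp (g := H f) (hH f _ (hmem t ht)) (hlan t)
  have hzero : (fun t => H f (l t)) =ᶠ[𝓝 0] 0 := by
    refine analyticOrderAt_eq_top.1 (ENat.eq_top_iff_forall_ge.2 fun n => ?_)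
    exact (natCast_le_analyticOrderAt_iff_iteratedDeriv_eq_zero (han 0 (by simp))).2
      fun i _ => hiter i f hf
  have := han.eqOn_zero_of_preconnected_of_eventuallyEq_zero isPreconnected_Icc
    (by simp) hzero (x := 1) (by simp)
  simp only [hl1, H, Pi.zero_apply, mul_eq_zero, Real.exp_ne_zero, false_or] at this
  exact this

/-- An analytic function annihilated by all `∇_a` is determined by its values on `S`. -/
theorem eq_zero_of_normalNabla_eq_zero {V : Set.Iic c.U} {f : AnalyticFn (c.tube V)}
    (hf : ∀ a : Fin d, c.nabla V (Sum.inr a) f = 0) (h0 : ∀ s ∈ V.1, f.1 (zeroSec s) = 0) :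
    f = 0 := by
  refine c.eq_zero_of_normalNabla_stable (ℝ ∙ f) (fun g hg a => ?_) (fun g hg s hs => ?_)
    (Submodule.mem_span_singleton_self f)
  · obtain ⟨r, rfl⟩ := Submodule.mem_span_singleton.1 hg
    rw [map_smul, hf, smul_zero]
    exact Submodule.zero_mem _
  · obtain ⟨r, rfl⟩ := Submodule.mem_span_singleton.1 hg
    change r * f.1 (zeroSec s) = 0
    rw [h0 s hs, mul_zero]

theorem nabla_op_apply {V : Set.Iic c.U} (P : c.ops V) (a : Fin d) (f : AnalyticFn (c.tube V)) :
    c.nabla V (Sum.inr a) (P.1 f) = P.1 (c.nabla V (Sum.inr a) f) :=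
  (LinearMap.congr_fun (congrArg Subtype.val (c.normalNabla_comm V a P)) f).symm

/-- An operator in `i_S^* 𝒟_T` is determined by the restrictions to `S` of its values. Its range is
stable under the `∇_a`, because these commute with the operator. -/
theorem op_ext {V : Set.Iic c.U} {P Q : c.ops V}
    (h : ∀ f : AnalyticFn (c.tube V), ∀ s ∈ V.1, (P.1 f).1 (zeroSec s) = (Q.1 f).1 (zeroSec s)) :
    P = Q := by
  rw [← sub_eq_zero]
  refine Subtype.ext (LinearMap.ext fun f => ?_)
  refine c.eq_zero_of_normalNabla_stable (LinearMap.range (P - Q).1) ?_ ?_ ⟨f, rfl⟩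
  · rintro _ ⟨g, rfl⟩ a
    exact ⟨_, (c.nabla_op_apply (P - Q) a g).symm⟩
  · rintro _ ⟨g, rfl⟩ s hs
    change (P.1 g).1 (zeroSec s) - (Q.1 g).1 (zeroSec s) = 0
    rw [h g s hs, sub_self]

/-- The algebra `𝒟_S` of differential operators with analytic coefficients on `V`. -/
noncomputable def baseOps (V : Set.Iic c.U) : Subalgebra ℝ (Module.End ℝ (AnalyticFn V.1)) :=
  Algebra.adjoin ℝ (range (fun a : AnalyticFn V.1 => mulOp V.1 a.1 a.2) ∪ range (pdOp V.1))

/-- Every differential operator on `S` is the restriction of an operator of `i_S^* 𝒟_T`: `∂_α` is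
the restriction of `∇_α - (1/4) (∂_α log g_T)|_S`. -/
theorem exists_lift {V : Set.Iic c.U} {Q : Module.End ℝ (AnalyticFn V.1)} (hQ : Q ∈ c.baseOps V) :
    ∃ P : c.ops V, ∀ f, c.restrictS V (P.1 f) = Q (c.restrictS V f) := by
  have hmul (a : AnalyticFn V.1) : ∃ P : c.ops V, ∀ f, ∀ s ∈ V.1,
      (P.1 f).1 (zeroSec s) = a.1 s * f.1 (zeroSec s) :=
    ⟨⟨c.mulBase V a, Algebra.subset_adjoin (Or.inl ⟨_, rfl⟩)⟩, fun f s hs =>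
      mulOp_apply (c.analyticOnNhd_base V a) f (c.zeroSec_mem hs)⟩
  refine Algebra.adjoin_induction (fun Q hQ => ?_) (fun r => ?_) (fun Q₁ Q₂ _ _ h₁ h₂ => ?_)
    (fun Q₁ Q₂ _ _ h₁ h₂ => ?_) hQ
  · obtain ⟨a, rfl⟩ | ⟨α, rfl⟩ := hQ
    · obtain ⟨P, hP⟩ := hmul a
      refine ⟨P, fun f => AnalyticFn.ext' fun s hs => ?_⟩
      rw [c.restrictS_apply _ hs, hP f s hs, mulOp_apply a.2 _ hs, c.restrictS_apply _ hs]
    · have ha : AnalyticOnNhd ℝ (fun s => 1 / 4 * pd c.logVol (Sum.inl α) (zeroSec s)) V.1 :=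
        fun s hs => analyticAt_const.fun_mul (analyticAt_comp_zeroSec
          (analyticOnNhd_pd (c.analyticOnNhd_logVol V) _ _ (c.zeroSec_mem hs)))
      obtain ⟨P, hP⟩ := hmul (AnalyticFn.of V.1 _ ha)
      refine ⟨⟨c.nabla V (Sum.inl α), Algebra.subset_adjoin (Or.inr ⟨_, rfl⟩)⟩ - P,
        fun f => AnalyticFn.ext' fun s hs => ?_⟩
      rw [c.restrictS_apply _ hs, pdOp_apply α _ hs]
      change (c.nabla V (Sum.inl α) f).1 (zeroSec s) - (P.1 f).1 (zeroSec s) = _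
      rw [hP f s hs, AnalyticFn.of_apply ha hs, c.nabla_apply _ f (c.zeroSec_mem hs),
        pd_congr (fun t ht => c.restrictS_apply f ht) α hs,
        pd_comp_zeroSec (f.analytic _ (c.zeroSec_mem hs))]
      ring
  · refine ⟨algebraMap ℝ _ r, fun f => AnalyticFn.ext' fun s hs => ?_⟩
    rw [c.restrictS_apply _ hs]
    exact congrArg (r * ·) (c.restrictS_apply f hs).symm
  · obtain ⟨P₁, h₁⟩ := h₁
    obtain ⟨P₂, h₂⟩ := h₂
    refine ⟨P₁ + P₂, fun f => AnalyticFn.ext' fun s hs => ?_⟩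
    rw [LinearMap.add_apply, ← h₁, ← h₂, c.restrictS_apply _ hs]
    exact congrArg₂ (· + ·) (c.restrictS_apply _ hs).symm (c.restrictS_apply _ hs).symm
  · obtain ⟨P₁, h₁⟩ := h₁
    obtain ⟨P₂, h₂⟩ := h₂
    refine ⟨P₁ * P₂, fun f => ?_⟩
    rw [Module.End.mul_apply, ← h₂, ← h₁]
    rfl

/-! ### The metric of the tubular neighborhood -/

theorem inner_pd_X_e {s : Fin k → ℝ} (hs : s ∈ c.U) (α : Fin k) (a : Fin d) :
    inner ℝ (pd c.X α s) (c.e a s) = 0 := by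
  refine Submodule.mem_orthogonal _ _ |>.1 (c.e_normal a s hs) _ (Submodule.subset_span ?_)
  have hline : HasDerivAt (fun t : ℝ => s + t • (Pi.single α 1 : Fin k → ℝ)) (Pi.single α 1) 0 := by
    have h := ((hasDerivAt_id (0 : ℝ)).smul_const (Pi.single α 1 : Fin k → ℝ)).const_add s
    rwa [one_smul] at h
  have h0 : s + (0 : ℝ) • (Pi.single α 1 : Fin k → ℝ) = s := by simp
  refine ⟨fun t => c.X (s + t • (Pi.single α 1 : Fin k → ℝ)), by simp, ?_, ?_⟩
  · have hc : ∀ᶠ t in 𝓝 (0 : ℝ), s + t • (Pi.single α 1 : Fin k → ℝ) ∈ c.U :=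
      hline.continuousAt.eventually (c.U.isOpen.mem_nhds (by simpa using hs))
    filter_upwards [hc] with t ht using c.X_mem ht
  · refine HasFDerivAt.comp_hasDerivAt (l := c.X) (l' := fderiv ℝ c.X s) 0 ?_ hline
    rw [h0]
    exact (c.param.analytic s hs).differentiableAt.hasFDerivAt

/-- The Gram matrix `⟨e_a, e_b⟩` of the normal frame. -/
noncomputable def frameGram (s : Fin k → ℝ) : Matrix (Fin d) (Fin d) ℝ :=
  Matrix.gram ℝ fun a => c.e a s

/-- The coefficients `⟨e_a, ∂_β e_b⟩` of the normal connection. -/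
noncomputable def normalConn (a b : Fin d) (β : Fin k) (s : Fin k → ℝ) : ℝ :=
  inner ℝ (c.e a s) (pd (c.e b) β s)

theorem det_metric_X_pos {s : Fin k → ℝ} (hs : s ∈ c.U) : 0 < (metric c.X s).det := by
  refine (Matrix.posDef_gram_of_linearIndependent (𝕜 := ℝ) ?_).det_pos
  have h := (Pi.basisFun ℝ (Fin k)).linearIndependent.map' (fderiv ℝ c.X s).toLinearMap
    (LinearMap.ker_eq_bot.2 (c.param.immersion s hs))
  simpa [Function.comp_def, pd] using h

theorem det_frameGram_pos {s : Fin k → ℝ} (hs : s ∈ c.U) : 0 < (c.frameGram s).det :=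
  (Matrix.posDef_gram_of_linearIndependent (𝕜 := ℝ) (c.e_indep s hs)).det_pos

theorem det_metric_tubeMap_pos {V : Set.Iic c.U} {u : Fin k ⊕ Fin d → ℝ} (hu : u ∈ c.tube V) :
    0 < (metric c.tubeMap u).det :=
  (Matrix.posDef_gram_of_linearIndependent (𝕜 := ℝ) (c.tubeMap_immersion hu)).det_pos

theorem analyticAt_metric_X {s : Fin k → ℝ} (hs : s ∈ c.U) (α β : Fin k) :
    AnalyticAt ℝ (fun t => metric c.X t α β) s :=
  analyticAt_inner (analyticOnNhd_pd c.param.analytic α s hs)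
    (analyticOnNhd_pd c.param.analytic β s hs)

theorem analyticAt_frameGram {s : Fin k → ℝ} (hs : s ∈ c.U) (a b : Fin d) :
    AnalyticAt ℝ (fun t => c.frameGram t a b) s :=
  analyticAt_inner (c.e_analytic a s hs) (c.e_analytic b s hs)

theorem analyticAt_normalConn {s : Fin k → ℝ} (hs : s ∈ c.U) (a b : Fin d) (β : Fin k) :
    AnalyticAt ℝ (c.normalConn a b β) s :=
  analyticAt_inner (c.e_analytic a s hs) (analyticOnNhd_pd (c.e_analytic b) β s hs)

theorem analyticAt_metric_tubeMap {V : Set.Iic c.U} {u : Fin k ⊕ Fin d → ℝ} (hu : u ∈ c.tube V)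
    (μ ν : Fin k ⊕ Fin d) : AnalyticAt ℝ (fun v => metric c.tubeMap v μ ν) u :=
  analyticAt_inner (analyticOnNhd_pd (c.tubeMap_analytic V) μ u hu)
    (analyticOnNhd_pd (c.tubeMap_analytic V) ν u hu)

theorem analyticAt_weingarten {s : Fin k → ℝ} (hs : s ∈ c.U) (a : Fin d) (β α : Fin k) :
    AnalyticAt ℝ (fun t => c.weingarten a t β α) s := by
  simp only [weingarten, Matrix.of_apply]
  exact Finset.analyticAt_fun_sum _ fun δ _ =>
    (analyticAt_inv_apply (c.analyticAt_metric_X hs) (c.det_metric_X_pos hs).ne' β δ).fun_mul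
      (analyticAt_inner (analyticOnNhd_pd c.param.analytic δ s hs)
        (analyticOnNhd_pd (c.e_analytic a) α s hs))

theorem symm_frameGram_inv (s : Fin k → ℝ) (a b : Fin d) :
    (c.frameGram s)⁻¹ a b = (c.frameGram s)⁻¹ b a := by
  have h : (c.frameGram s).transpose = c.frameGram s := by
    ext i j
    exact real_inner_comm (c.e i s) (c.e j s)
  conv_lhs => rw [← h, ← Matrix.transpose_nonsing_inv, Matrix.transpose_apply]

theorem metric_X_mul_weingarten {s : Fin k → ℝ} (hs : s ∈ c.U) (a : Fin d) (δ α : Fin k) :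
    (metric c.X s * c.weingarten a s) δ α = inner ℝ (pd c.X δ s) (pd (c.e a) α s) := by
  have h : c.weingarten a s = (metric c.X s)⁻¹ *
      Matrix.of fun δ α => inner ℝ (pd c.X δ s) (pd (c.e a) α s) := by
    ext β α
    simp [weingarten, Matrix.mul_apply]
  rw [h, Matrix.mul_nonsing_inv_cancel_left _ _ (isUnit_iff_ne_zero.2 (c.det_metric_X_pos hs).ne'),
    Matrix.of_apply]

theorem pd_normalCoord (a b : Fin d) (u : Fin k ⊕ Fin d → ℝ) :
    pd (fun v : Fin k ⊕ Fin d → ℝ => v (Sum.inr a)) (Sum.inr b) u = if a = b then 1 else 0 := by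
  rw [pd, show (fun v : Fin k ⊕ Fin d → ℝ => v (Sum.inr a)) = ContinuousLinearMap.proj (R := ℝ)
    (φ := fun _ : Fin k ⊕ Fin d => ℝ) (Sum.inr a) from rfl, ContinuousLinearMap.fderiv]
  simp [Pi.single_apply]

theorem analyticAt_normalCoord (a : Fin d) (u : Fin k ⊕ Fin d → ℝ) :
    AnalyticAt ℝ (fun v : Fin k ⊕ Fin d → ℝ => v (Sum.inr a)) u :=
  (ContinuousLinearMap.proj (R := ℝ) (φ := fun _ : Fin k ⊕ Fin d => ℝ) (Sum.inr a)).analyticAt u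

theorem analyticAt_comp_foot {a : (Fin k → ℝ) → ℝ} {u : Fin k ⊕ Fin d → ℝ}
    (ha : AnalyticAt ℝ a (foot u)) : AnalyticAt ℝ (fun v => a (foot v)) u :=
  AnalyticAt.comp (g := a) ha (analyticAt_foot u)

/-- The normal derivatives of a function that is affine in `q`. -/
theorem pd_affine {A : (Fin k → ℝ) → ℝ} {B : Fin d → (Fin k → ℝ) → ℝ}
    {u : Fin k ⊕ Fin d → ℝ} (hA : AnalyticAt ℝ A (foot u)) (hB : ∀ a, AnalyticAt ℝ (B a) (foot u))
    (b : Fin d) :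
    pd (fun v => A (foot v) + ∑ a, v (Sum.inr a) * B a (foot v)) (Sum.inr b) u = B b (foot u) := by
  rw [pd_fun_add (analyticAt_comp_foot hA) (Finset.analyticAt_fun_sum _ fun a _ =>
      (analyticAt_normalCoord a u).fun_mul (analyticAt_comp_foot (hB a))),
    pd_comp_foot_inr hA, pd_sum (f := fun a v => v (Sum.inr a) * B a (foot v)) _ fun a _ =>
      (analyticAt_normalCoord a u).fun_mul (analyticAt_comp_foot (hB a))]
  have h : ∀ a, pd (fun v : Fin k ⊕ Fin d → ℝ => v (Sum.inr a) * B a (foot v)) (Sum.inr b) u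
      = if a = b then B a (foot u) else 0 := fun a => by
    rw [pd_mul' (f := fun v => v (Sum.inr a)) (g := fun v => B a (foot v))
      (analyticAt_normalCoord a u) (analyticAt_comp_foot (hB a)), pd_comp_foot_inr (hB a),
      pd_normalCoord]
    split_ifs <;> ring
  simp [h]

theorem pd_tubeMap_inl {u : Fin k ⊕ Fin d → ℝ} (hu : foot u ∈ c.U) (α : Fin k) :
    pd c.tubeMap (Sum.inl α) u
      = pd c.X α (foot u) + ∑ a, u (Sum.inr a) • pd (c.e a) α (foot u) := by
  have hX : AnalyticAt ℝ (fun v : Fin k ⊕ Fin d → ℝ => c.X (foot v)) u :=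
    AnalyticAt.comp (g := c.X) (c.param.analytic _ hu) (analyticAt_foot u)
  have he : ∀ a, AnalyticAt ℝ (fun v : Fin k ⊕ Fin d → ℝ => c.e a (foot v)) u := fun a =>
    AnalyticAt.comp (g := c.e a) (c.e_analytic a _ hu) (analyticAt_foot u)
  have hterm : ∀ a, DifferentiableAt ℝ
      (fun v : Fin k ⊕ Fin d → ℝ => v (Sum.inr a) • c.e a (foot v)) u := fun a =>
    ((analyticAt_normalCoord a u).fun_smul (he a)).differentiableAt
  rw [pd, show c.tubeMap = fun v => c.X (foot v) + ∑ a, v (Sum.inr a) • c.e a (foot v) from rfl,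
    fderiv_fun_add hX.differentiableAt (DifferentiableAt.fun_sum fun a _ => hterm a),
    fderiv_fun_sum fun a _ => hterm a, add_apply, sum_apply]
  congr 1
  · exact pd_comp_foot_inl (c.param.analytic _ hu) α
  · refine Finset.sum_congr rfl fun a _ => ?_
    rw [fderiv_fun_smul (analyticAt_normalCoord a u).differentiableAt (he a).differentiableAt]
    have h1 : fderiv ℝ (fun v : Fin k ⊕ Fin d → ℝ => v (Sum.inr a)) u
        (Pi.single (Sum.inl α) 1) = 0 := by
      rw [show (fun v : Fin k ⊕ Fin d → ℝ => v (Sum.inr a)) = ContinuousLinearMap.proj (R := ℝ)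
        (φ := fun _ : Fin k ⊕ Fin d => ℝ) (Sum.inr a) from rfl, ContinuousLinearMap.fderiv]
      simp
    have h2 : fderiv ℝ (fun v : Fin k ⊕ Fin d → ℝ => c.e a (foot v)) u (Pi.single (Sum.inl α) 1)
        = pd (c.e a) α (foot u) := pd_comp_foot_inl (c.e_analytic a _ hu) α
    simp [h1, h2]

theorem pd_tubeMap_inr {u : Fin k ⊕ Fin d → ℝ} (hu : foot u ∈ c.U) (b : Fin d) :
    pd c.tubeMap (Sum.inr b) u = c.e b (foot u) := by
  have hX : AnalyticAt ℝ (fun v : Fin k ⊕ Fin d → ℝ => c.X (foot v)) u :=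
    AnalyticAt.comp (g := c.X) (c.param.analytic _ hu) (analyticAt_foot u)
  have he : ∀ a, AnalyticAt ℝ (fun v : Fin k ⊕ Fin d → ℝ => c.e a (foot v)) u := fun a =>
    AnalyticAt.comp (g := c.e a) (c.e_analytic a _ hu) (analyticAt_foot u)
  have hterm : ∀ a, DifferentiableAt ℝ
      (fun v : Fin k ⊕ Fin d → ℝ => v (Sum.inr a) • c.e a (foot v)) u := fun a =>
    ((analyticAt_normalCoord a u).fun_smul (he a)).differentiableAt
  rw [pd, show c.tubeMap = fun v => c.X (foot v) + ∑ a, v (Sum.inr a) • c.e a (foot v) from rfl,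
    fderiv_fun_add hX.differentiableAt (DifferentiableAt.fun_sum fun a _ => hterm a),
    fderiv_fun_sum fun a _ => hterm a, add_apply, sum_apply]
  have h0 : fderiv ℝ (fun v : Fin k ⊕ Fin d → ℝ => c.X (foot v)) u (Pi.single (Sum.inr b) 1) = 0 :=
    pd_comp_foot_inr (c.param.analytic _ hu) b
  have h : ∀ a, fderiv ℝ (fun v : Fin k ⊕ Fin d → ℝ => v (Sum.inr a) • c.e a (foot v)) u
      (Pi.single (Sum.inr b) 1) = if a = b then c.e a (foot u) else 0 := fun a => by
    rw [fderiv_fun_smul (analyticAt_normalCoord a u).differentiableAt (he a).differentiableAt]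
    have h1 := pd_normalCoord a b u
    have h2 : fderiv ℝ (fun v : Fin k ⊕ Fin d → ℝ => c.e a (foot v)) u (Pi.single (Sum.inr b) 1)
        = 0 := pd_comp_foot_inr (c.e_analytic a _ hu) b
    rw [pd] at h1
    simp [h1, h2]
  simp [h0, h]

theorem metric_tubeMap_inr_inr {u : Fin k ⊕ Fin d → ℝ} (hu : foot u ∈ c.U) (a b : Fin d) :
    metric c.tubeMap u (Sum.inr a) (Sum.inr b) = c.frameGram (foot u) a b := by
  rw [metric, Matrix.gram_apply, c.pd_tubeMap_inr hu, c.pd_tubeMap_inr hu, frameGram,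
    Matrix.gram_apply]

theorem metric_tubeMap_inr_inl {u : Fin k ⊕ Fin d → ℝ} (hu : foot u ∈ c.U) (a : Fin d)
    (β : Fin k) :
    metric c.tubeMap u (Sum.inr a) (Sum.inl β)
      = ∑ b, u (Sum.inr b) * c.normalConn a b β (foot u) := by
  rw [metric, Matrix.gram_apply, c.pd_tubeMap_inr hu, c.pd_tubeMap_inl hu, inner_add_right,
    real_inner_comm, c.inner_pd_X_e hu, zero_add, inner_sum]
  simp only [real_inner_smul_right, normalConn]

theorem metric_zeroSec {s : Fin k → ℝ} (hs : s ∈ c.U) :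
    metric c.tubeMap (zeroSec s) = Matrix.fromBlocks (metric c.X s) 0 0 (c.frameGram s) := by
  have hu : foot (zeroSec s : Fin k ⊕ Fin d → ℝ) ∈ c.U := hs
  have h0 : ∀ b : Fin d, (zeroSec s : Fin k ⊕ Fin d → ℝ) (Sum.inr b) = 0 := fun _ => rfl
  have h10 : ∀ a β, metric c.tubeMap (zeroSec s) (Sum.inr a) (Sum.inl β) = 0 := fun a β => by
    rw [c.metric_tubeMap_inr_inl hu]
    simp [h0]
  ext (α | a) (β | b)
  · rw [metric, Matrix.gram_apply, c.pd_tubeMap_inl hu, c.pd_tubeMap_inl hu]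
    simp [h0, metric, foot_zeroSec]
  · rw [Matrix.fromBlocks_apply₁₂, Matrix.zero_apply, ← h10 b α]
    exact real_inner_comm (pd c.tubeMap (Sum.inr b) _) (pd c.tubeMap (Sum.inl α) _)
  · exact h10 a β
  · exact c.metric_tubeMap_inr_inr hu a b

theorem inv_metric_zeroSec {s : Fin k → ℝ} (hs : s ∈ c.U) :
    (metric c.tubeMap (zeroSec s))⁻¹
      = Matrix.fromBlocks (metric c.X s)⁻¹ 0 0 (c.frameGram s)⁻¹ := by
  refine Matrix.inv_eq_right_inv ?_
  rw [c.metric_zeroSec hs, Matrix.fromBlocks_multiply,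
    Matrix.mul_nonsing_inv _ (isUnit_iff_ne_zero.2 (c.det_metric_X_pos hs).ne'),
    Matrix.mul_nonsing_inv _ (isUnit_iff_ne_zero.2 (c.det_frameGram_pos hs).ne')]
  simp

theorem normalMetricInv_eq {s : Fin k → ℝ} (hs : s ∈ c.U) (a b : Fin d) :
    c.normalMetricInv s a b = (c.frameGram s)⁻¹ a b := by
  rw [normalMetricInv, c.inv_metric_zeroSec hs, Matrix.fromBlocks_apply₂₂]

theorem det_metric_zeroSec {s : Fin k → ℝ} (hs : s ∈ c.U) :
    (metric c.tubeMap (zeroSec s)).det = (metric c.X s).det * (c.frameGram s).det := by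
  rw [c.metric_zeroSec hs, Matrix.det_fromBlocks_zero₂₁]

/-- For two families of `n` vectors in `𝔼^n`, the product of the Gram determinants is the square
of the mixed Gram determinant. -/
theorem det_gram_mul_det_gram (v b : Fin k ⊕ Fin d → Euc (k + d)) :
    (Matrix.gram ℝ v).det * (Matrix.gram ℝ b).det
      = (Matrix.of fun ν μ => (inner ℝ (b ν) (v μ) : ℝ)).det ^ 2 := by
  let M : (Fin k ⊕ Fin d → Euc (k + d)) → Matrix (Fin k ⊕ Fin d) (Fin k ⊕ Fin d) ℝ :=
    fun w => Matrix.of fun i μ => w μ (finSumFinEquiv i)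
  have h : ∀ w w' : Fin k ⊕ Fin d → Euc (k + d),
      (Matrix.of fun ν μ => (inner ℝ (w ν) (w' μ) : ℝ)) = (M w).transpose * M w' := by
    intro w w'
    ext ν μ
    rw [Matrix.of_apply, PiLp.inner_apply, Matrix.mul_apply,
      ← Equiv.sum_comp (finSumFinEquiv (m := k) (n := d))]
    refine Finset.sum_congr rfl fun i _ => ?_
    simp [M, mul_comm]
  have hg : ∀ w : Fin k ⊕ Fin d → Euc (k + d), Matrix.gram ℝ w = (M w).transpose * M w :=
    fun w => h w w
  rw [h, hg, hg]
  simp only [Matrix.det_mul, Matrix.det_transpose]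
  ring

/-- The matrix `1 + q^a γ_a(s)`, which expresses the tangential part of `∂_α` at `(s, q)` by the
frame `e_β` at `(s, 0)`. -/
noncomputable def shape (u : Fin k ⊕ Fin d → ℝ) : Matrix (Fin k) (Fin k) ℝ :=
  1 + ∑ a, u (Sum.inr a) • c.weingarten a (foot u)

theorem shape_apply (u : Fin k ⊕ Fin d → ℝ) (i j : Fin k) :
    c.shape u i j = (1 : Matrix (Fin k) (Fin k) ℝ) i j
      + ∑ a, u (Sum.inr a) * c.weingarten a (foot u) i j := by
  simp [shape, Matrix.sum_apply]

theorem det_metric_tubeMap {u : Fin k ⊕ Fin d → ℝ} (hu : foot u ∈ c.U) :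
    (metric c.tubeMap u).det = (c.shape u).det ^ 2 *
      ((metric c.X (foot u)).det * (c.frameGram (foot u)).det) := by
  have h := det_gram_mul_det_gram (fun μ => pd c.tubeMap μ u)
    fun μ => pd c.tubeMap μ (zeroSec (foot u))
  have hu0 : foot (zeroSec (foot u) : Fin k ⊕ Fin d → ℝ) ∈ c.U := hu
  have h0 : ∀ b : Fin d, (zeroSec (foot u) : Fin k ⊕ Fin d → ℝ) (Sum.inr b) = 0 := fun _ => rfl
  have hC : (Matrix.of fun ν μ =>
      (inner ℝ (pd c.tubeMap ν (zeroSec (foot u))) (pd c.tubeMap μ u) : ℝ))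
      = Matrix.fromBlocks (metric c.X (foot u) * c.shape u) 0
        (Matrix.of fun a β => ∑ b, u (Sum.inr b) * c.normalConn a b β (foot u))
        (c.frameGram (foot u)) := by
    ext (δ | a) (α | b)
    · rw [Matrix.of_apply, c.pd_tubeMap_inl hu0, c.pd_tubeMap_inl hu, Matrix.fromBlocks_apply₁₁,
        shape, Matrix.mul_add, Matrix.mul_one, Matrix.add_apply, Finset.mul_sum, Matrix.sum_apply]
      simp only [h0, zero_smul, Finset.sum_const_zero, add_zero, inner_add_right, inner_sum,
        real_inner_smul_right, Matrix.mul_smul, Matrix.smul_apply, smul_eq_mul,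
        c.metric_X_mul_weingarten hu, foot_zeroSec]
      rfl
    · rw [Matrix.of_apply, c.pd_tubeMap_inl hu0, c.pd_tubeMap_inr hu, Matrix.fromBlocks_apply₁₂]
      simp [h0, foot_zeroSec, c.inner_pd_X_e hu]
    · rw [Matrix.of_apply, c.pd_tubeMap_inr hu0, Matrix.fromBlocks_apply₂₁, Matrix.of_apply,
        ← c.metric_tubeMap_inr_inl hu, metric, Matrix.gram_apply, c.pd_tubeMap_inr hu]
      rfl
    · rw [Matrix.of_apply, c.pd_tubeMap_inr hu0, c.pd_tubeMap_inr hu, Matrix.fromBlocks_apply₂₂]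
      rfl
  rw [hC, Matrix.det_fromBlocks_zero₁₂, Matrix.det_mul] at h
  change (metric c.tubeMap u).det * (metric c.tubeMap (zeroSec (foot u))).det = _ at h
  rw [c.det_metric_zeroSec hu] at h
  have h1 := (c.det_metric_X_pos hu).ne'
  have h2 := (c.det_frameGram_pos hu).ne'
  refine mul_right_cancel₀ (mul_ne_zero h1 h2) (h.trans ?_)
  ring

theorem det_shape_ne_zero {V : Set.Iic c.U} {u : Fin k ⊕ Fin d → ℝ} (hu : u ∈ c.tube V) :
    (c.shape u).det ≠ 0 := fun h => by
  have := c.det_metric_tubeMap_pos hu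
  rw [c.det_metric_tubeMap (V.2 hu.1), h] at this
  simp at this

theorem analyticAt_shape {u : Fin k ⊕ Fin d → ℝ} (hu : foot u ∈ c.U) (i j : Fin k) :
    AnalyticAt ℝ (fun v => c.shape v i j) u := by
  simp only [shape_apply]
  exact analyticAt_const.fun_add (Finset.analyticAt_fun_sum _ fun a _ =>
    (analyticAt_normalCoord a u).fun_mul (analyticAt_comp_foot (c.analyticAt_weingarten hu a i j)))

theorem matPd_shape {u : Fin k ⊕ Fin d → ℝ} (hu : foot u ∈ c.U) (b : Fin d) :
    matPd c.shape (Sum.inr b) u = c.weingarten b (foot u) := by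
  ext i j
  simp only [matPd, Matrix.of_apply, shape_apply]
  exact pd_affine (A := fun _ => (1 : Matrix (Fin k) (Fin k) ℝ) i j)
    (B := fun a s => c.weingarten a s i j) analyticAt_const
    (fun a => c.analyticAt_weingarten hu a i j) b

theorem shape_zeroSec (s : Fin k → ℝ) : c.shape (zeroSec s) = 1 := by
  simp [shape, zeroSec]

theorem pd_logVol_inr {V : Set.Iic c.U} {u : Fin k ⊕ Fin d → ℝ} (hu : u ∈ c.tube V) (b : Fin d) :
    pd c.logVol (Sum.inr b) u = 2 * ((c.shape u)⁻¹ * c.weingarten b (foot u)).trace := by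
  have hU : foot u ∈ c.U := V.2 hu.1
  have hB : AnalyticAt ℝ
      (fun s => Real.log ((metric c.X s).det * (c.frameGram s).det)) (foot u) := by
    have hpos := mul_pos (c.det_metric_X_pos hU) (c.det_frameGram_pos hU)
    exact (((analyticAt_det (c.analyticAt_metric_X hU)).fun_mul
      (analyticAt_det (c.analyticAt_frameGram hU))).contDiffAt.log hpos.ne').analyticAt
  have hdet := analyticAt_det (c.analyticAt_shape hU)
  have hlog : AnalyticAt ℝ (fun v => Real.log (c.shape v).det) u :=
    (hdet.contDiffAt.log (c.det_shape_ne_zero hu)).analyticAt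
  have h : ∀ v ∈ c.tube V, c.logVol v = 2 * Real.log (c.shape v).det
      + Real.log ((metric c.X (foot v)).det * (c.frameGram (foot v)).det) := fun v hv => by
    have hv' : foot v ∈ c.U := V.2 hv.1
    rw [logVol, c.det_metric_tubeMap hv', Real.log_mul (pow_ne_zero _ (c.det_shape_ne_zero hv))
      (mul_pos (c.det_metric_X_pos hv') (c.det_frameGram_pos hv')).ne', Real.log_pow]
    norm_num
  rw [pd_congr h _ hu, pd_fun_add (analyticAt_const.fun_mul hlog) (analyticAt_comp_foot hB),
    pd_comp_foot_inr hB, pd_const_mul hlog,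
    pd_log_det (c.analyticAt_shape hU) (c.det_shape_ne_zero hu), c.matPd_shape hU, add_zero]

theorem pd_logVol_zeroSec {V : Set.Iic c.U} {s : Fin k → ℝ} (hs : s ∈ V.1) (b : Fin d) :
    pd c.logVol (Sum.inr b) (zeroSec s) = 2 * (c.weingarten b s).trace := by
  rw [c.pd_logVol_inr (c.zeroSec_mem hs), shape_zeroSec, inv_one, Matrix.one_mul, foot_zeroSec]

theorem pd_pd_logVol_zeroSec {V : Set.Iic c.U} {s : Fin k → ℝ} (hs : s ∈ V.1) (a b : Fin d) :
    pd (pd c.logVol (Sum.inr b)) (Sum.inr a) (zeroSec s)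
      = -2 * (c.weingarten a s * c.weingarten b s).trace := by
  have hu := c.zeroSec_mem hs
  have hU : foot (zeroSec s : Fin k ⊕ Fin d → ℝ) ∈ c.U := V.2 hs
  have h : ∀ v ∈ c.tube V, pd c.logVol (Sum.inr b) v
      = 2 * ∑ i, ∑ j, (c.shape v)⁻¹ i j * c.weingarten b (foot v) j i := fun v hv => by
    rw [c.pd_logVol_inr hv]
    simp [Matrix.trace, Matrix.mul_apply]
  have hinv := analyticAt_inv_apply (c.analyticAt_shape hU) (c.det_shape_ne_zero hu)
  have hw : ∀ i j, AnalyticAt ℝ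
      (fun v : Fin k ⊕ Fin d → ℝ => c.weingarten b (foot v) j i) (zeroSec s) :=
    fun i j => analyticAt_comp_foot (c.analyticAt_weingarten hU b j i)
  have han : ∀ i j, AnalyticAt ℝ
      (fun v => (c.shape v)⁻¹ i j * c.weingarten b (foot v) j i) (zeroSec s) :=
    fun i j => (hinv i j).fun_mul (hw i j)
  rw [pd_congr h _ hu, pd_const_mul (Finset.analyticAt_fun_sum _ fun i _ =>
      Finset.analyticAt_fun_sum _ fun j _ => han i j),
    pd_sum (f := fun i v => ∑ j, (c.shape v)⁻¹ i j * c.weingarten b (foot v) j i) _ fun i _ =>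
      Finset.analyticAt_fun_sum _ fun j _ => han i j]
  have hterm : ∀ i j, pd (fun v => (c.shape v)⁻¹ i j * c.weingarten b (foot v) j i) (Sum.inr a)
      (zeroSec s) = -(c.weingarten a s i j * c.weingarten b s j i) := fun i j => by
    rw [pd_mul' (hinv i j) (hw i j),
      pd_comp_foot_inr (a := fun t => c.weingarten b t j i) (c.analyticAt_weingarten hU b j i),
      pd_inv_apply (c.analyticAt_shape hU) (c.det_shape_ne_zero hu), c.matPd_shape hU,
      shape_zeroSec, inv_one, Matrix.one_mul, Matrix.mul_one, foot_zeroSec]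
    ring
  have hsum : ∀ i, pd (fun v => ∑ j, (c.shape v)⁻¹ i j * c.weingarten b (foot v) j i) (Sum.inr a)
      (zeroSec s) = -(c.weingarten a s * c.weingarten b s) i i := fun i => by
    rw [pd_sum (f := fun j v => (c.shape v)⁻¹ i j * c.weingarten b (foot v) j i) _
      fun j _ => han i j, Matrix.mul_apply, ← Finset.sum_neg_distrib]
    exact Finset.sum_congr rfl fun j _ => hterm i j
  simp only [hsum, Finset.sum_neg_distrib, Matrix.trace, Matrix.diag_apply]
  ring

/-! ### The Laplacian of the tubular neighborhood on the submanifold -/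

/-- The first row of blocks is left unspecified: it does not enter the second row of blocks of the
derivative of the inverse metric. -/
theorem matPd_metric_inr {V : Set.Iic c.U} {s : Fin k → ℝ} (hs : s ∈ V.1) (b : Fin d) :
    ∃ A B, matPd (metric c.tubeMap) (Sum.inr b) (zeroSec s)
      = Matrix.fromBlocks A B (Matrix.of fun a β => c.normalConn a b β s) 0 := by
  have hu := c.zeroSec_mem hs
  have hU : foot (zeroSec s : Fin k ⊕ Fin d → ℝ) ∈ c.U := V.2 hs
  refine ⟨(matPd (metric c.tubeMap) (Sum.inr b) (zeroSec s)).toBlocks₁₁,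
    (matPd (metric c.tubeMap) (Sum.inr b) (zeroSec s)).toBlocks₁₂, ?_⟩
  ext (α | a) (β | a')
  · rfl
  · rfl
  · rw [Matrix.fromBlocks_apply₂₁, matPd, Matrix.of_apply, Matrix.of_apply,
      pd_congr (O := c.tube V) (fun v hv => (c.metric_tubeMap_inr_inl (V.2 hv.1) a β).trans
        (zero_add _).symm) _ hu]
    exact pd_affine (A := fun _ => 0) (B := fun b => c.normalConn a b β) analyticAt_const
      (fun b => c.analyticAt_normalConn hU a b β) b
  · rw [Matrix.fromBlocks_apply₂₂, matPd, Matrix.of_apply,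
      pd_congr (O := c.tube V) (fun v hv => c.metric_tubeMap_inr_inr (V.2 hv.1) a a') _ hu]
    exact pd_comp_foot_inr (a := fun t => c.frameGram t a a') (c.analyticAt_frameGram hU a a') b

theorem pd_inv_metric_inr_inl {V : Set.Iic c.U} {s : Fin k → ℝ} (hs : s ∈ V.1) (a b : Fin d)
    (β : Fin k) :
    pd (fun v => (metric c.tubeMap v)⁻¹ (Sum.inr a) (Sum.inl β)) (Sum.inr b) (zeroSec s)
      = -∑ α, (∑ a', (c.frameGram s)⁻¹ a a' * c.normalConn a' b α s) * (metric c.X s)⁻¹ α β := by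
  have hu := c.zeroSec_mem hs
  obtain ⟨A, B, h⟩ := c.matPd_metric_inr hs b
  rw [pd_inv_apply (c.analyticAt_metric_tubeMap hu) (c.det_metric_tubeMap_pos hu).ne', h,
    c.inv_metric_zeroSec (V.2 hs), Matrix.fromBlocks_multiply, Matrix.fromBlocks_multiply]
  simp [Matrix.mul_apply]

theorem pd_inv_metric_inr_inr {V : Set.Iic c.U} {s : Fin k → ℝ} (hs : s ∈ V.1) (a a' b : Fin d) :
    pd (fun v => (metric c.tubeMap v)⁻¹ (Sum.inr a) (Sum.inr a')) (Sum.inr b) (zeroSec s) = 0 := by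
  have hu := c.zeroSec_mem hs
  obtain ⟨A, B, h⟩ := c.matPd_metric_inr hs b
  rw [pd_inv_apply (c.analyticAt_metric_tubeMap hu) (c.det_metric_tubeMap_pos hu).ne', h,
    c.inv_metric_zeroSec (V.2 hs), Matrix.fromBlocks_multiply, Matrix.fromBlocks_multiply]
  simp

theorem pd_log_det_frameGram {s : Fin k → ℝ} (hs : s ∈ c.U) (α : Fin k) :
    pd (fun t => Real.log (c.frameGram t).det) α s
      = 2 * ∑ a, ∑ b, (c.frameGram s)⁻¹ a b * c.normalConn b a α s := by
  rw [pd_log_det (c.analyticAt_frameGram hs) (c.det_frameGram_pos hs).ne', Matrix.trace]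
  have h : ∀ a b, matPd c.frameGram α s b a = c.normalConn b a α s + c.normalConn a b α s := by
    intro a b
    refine (pd_inner (c.e_analytic b s hs) (c.e_analytic a s hs) α).trans ?_
    rw [real_inner_comm (c.e a s)]
    rfl
  simp only [Matrix.diag_apply, Matrix.mul_apply, h, mul_add, Finset.sum_add_distrib]
  rw [two_mul]
  congr 1
  rw [Finset.sum_comm]
  exact Finset.sum_congr rfl fun a _ => Finset.sum_congr rfl fun b _ => by
    rw [c.symm_frameGram_inv]

theorem analyticAt_pd_comp_zeroSec {V : Set.Iic c.U} (f : AnalyticFn (c.tube V)) {s : Fin k → ℝ}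
    (hs : s ∈ V.1) (β : Fin k) :
    AnalyticAt ℝ (pd (fun t => f.1 (zeroSec t)) β) s :=
  analyticOnNhd_pd (s := V.1) (fun _ ht => analyticAt_comp_zeroSec
    (f.analytic _ (c.zeroSec_mem ht))) β s hs

/-- The Beltrami-Laplace operator of `T` on `S`. The first order terms `∂_β` which come from the
volume `√(det ⟨e_a, e_b⟩)` of the normal frame and from the derivatives `∂_a g_T^{aβ}` cancel, both
being the trace of the normal connection. -/
theorem beltrami_tubeMap_zeroSec {V : Set.Iic c.U} (f : AnalyticFn (c.tube V)) {s : Fin k → ℝ}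
    (hs : s ∈ V.1) :
    beltrami c.tubeMap f.1 (zeroSec s) = beltrami c.X (fun t => f.1 (zeroSec t)) s
      + ∑ a, ∑ b, (c.frameGram s)⁻¹ a b * (pd (pd f.1 (Sum.inr b)) (Sum.inr a) (zeroSec s)
        + 1 / 2 * pd c.logVol (Sum.inr a) (zeroSec s) * pd f.1 (Sum.inr b) (zeroSec s)) := by
  have hu := c.zeroSec_mem hs
  have hX := c.det_metric_X_pos (V.2 hs)
  have hN := c.det_frameGram_pos (V.2 hs)
  have hT := c.det_metric_tubeMap_pos hu
  have hsX : √(metric c.X s).det ≠ 0 := (Real.sqrt_pos.2 hX).ne'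
  have hsN : √(c.frameGram s).det ≠ 0 := (Real.sqrt_pos.2 hN).ne'
  have hsqrt : ∀ t ∈ V.1, √(metric c.tubeMap (zeroSec t)).det
      = √(metric c.X t).det * √(c.frameGram t).det := fun t ht => by
    rw [c.det_metric_zeroSec (V.2 ht), Real.sqrt_mul (c.det_metric_X_pos (V.2 ht)).le]
  have hD := analyticAt_det (c.analyticAt_metric_tubeMap hu)
  have hDs := analyticAt_sqrt hD hT
  have hinv := analyticAt_inv_apply (c.analyticAt_metric_tubeMap hu) hT.ne'
  have hf' : ∀ ν, AnalyticAt ℝ (pd f.1 ν) (zeroSec s) := fun ν => analyticOnNhd_pd f.analytic ν _ hu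
  have hY : ∀ μ, AnalyticAt ℝ (fun v => ∑ ν, (metric c.tubeMap v)⁻¹ μ ν * pd f.1 ν v) (zeroSec s) :=
    fun μ => Finset.analyticAt_fun_sum _ fun ν _ => (hinv μ ν).fun_mul (hf' ν)
  set φ : (Fin k → ℝ) → ℝ := fun t => f.1 (zeroSec t) with hφ
  have hYX : ∀ α, AnalyticAt ℝ (fun t => ∑ β, (metric c.X t)⁻¹ α β * pd φ β t) s :=
    fun α => Finset.analyticAt_fun_sum _ fun β _ =>
      (analyticAt_inv_apply (c.analyticAt_metric_X (V.2 hs)) hX.ne' α β).fun_mul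
        (c.analyticAt_pd_comp_zeroSec f hs β)
  have hXs := analyticAt_sqrt (analyticAt_det (c.analyticAt_metric_X (V.2 hs))) hX
  have hNs := analyticAt_sqrt (analyticAt_det (c.analyticAt_frameGram (V.2 hs))) hN
  have htan : ∀ α, pd (fun v => √(metric c.tubeMap v).det *
        ∑ ν, (metric c.tubeMap v)⁻¹ (Sum.inl α) ν * pd f.1 ν v) (Sum.inl α) (zeroSec s)
      = √(c.frameGram s).det * (pd (fun t => √(metric c.X t).det *
          ∑ β, (metric c.X t)⁻¹ α β * pd φ β t) α s
        + √(metric c.X s).det * ∑ β, (metric c.X s)⁻¹ α β * pd φ β s *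
          ∑ a, ∑ b, (c.frameGram s)⁻¹ a b * c.normalConn b a α s) := fun α => by
    rw [← pd_comp_zeroSec (hDs.fun_mul (hY (Sum.inl α))),
      pd_congr (O := V.1) (g := fun t => (√(metric c.X t).det *
        ∑ β, (metric c.X t)⁻¹ α β * pd φ β t) * √(c.frameGram t).det) (fun t ht => ?_) α hs,
      pd_mul' (f := fun t => √(metric c.X t).det * ∑ β, (metric c.X t)⁻¹ α β * pd φ β t)
        (hXs.fun_mul (hYX α)) hNs, pd_sqrt (analyticAt_det (c.analyticAt_frameGram (V.2 hs))) hN,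
      c.pd_log_det_frameGram (V.2 hs), ← Finset.sum_mul]
    · ring
    · rw [hsqrt t ht, c.inv_metric_zeroSec (V.2 ht), Fintype.sum_sum_type]
      simp only [Matrix.fromBlocks_apply₁₁, Matrix.fromBlocks_apply₁₂, Matrix.zero_apply, zero_mul,
        Finset.sum_const_zero, add_zero]
      have : ∀ β, pd f.1 (Sum.inl β) (zeroSec t) = pd φ β t := fun β =>
        (pd_comp_zeroSec (f.analytic _ (c.zeroSec_mem ht)) β).symm
      simp only [this]
      ring
  have hnor : ∀ a, pd (fun v => √(metric c.tubeMap v).det *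
        ∑ ν, (metric c.tubeMap v)⁻¹ (Sum.inr a) ν * pd f.1 ν v) (Sum.inr a) (zeroSec s)
      = √(metric c.tubeMap (zeroSec s)).det *
        ((∑ b, (c.frameGram s)⁻¹ a b * (pd (pd f.1 (Sum.inr b)) (Sum.inr a) (zeroSec s)
          + 1 / 2 * pd c.logVol (Sum.inr a) (zeroSec s) * pd f.1 (Sum.inr b) (zeroSec s)))
        - ∑ α, ∑ β, (metric c.X s)⁻¹ α β * pd φ β s *
          ∑ b, (c.frameGram s)⁻¹ a b * c.normalConn b a α s) := fun a => by
    have hterm : ∀ ν, pd (fun v => (metric c.tubeMap v)⁻¹ (Sum.inr a) ν * pd f.1 ν v) (Sum.inr a)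
        (zeroSec s) = (metric c.tubeMap (zeroSec s))⁻¹ (Sum.inr a) ν *
          pd (pd f.1 ν) (Sum.inr a) (zeroSec s) + pd f.1 ν (zeroSec s) *
          pd (fun v => (metric c.tubeMap v)⁻¹ (Sum.inr a) ν) (Sum.inr a) (zeroSec s) :=
      fun ν => pd_mul' (hinv _ ν) (hf' ν) _
    have hβ : ∀ β, pd f.1 (Sum.inl β) (zeroSec s) = pd φ β s := fun β =>
      (pd_comp_zeroSec (f.analytic _ hu) β).symm
    rw [pd_mul' hDs (hY (Sum.inr a)), pd_sqrt hD hT,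
      pd_sum (f := fun ν v => (metric c.tubeMap v)⁻¹ (Sum.inr a) ν * pd f.1 ν v) _
        fun ν _ => (hinv _ ν).fun_mul (hf' ν)]
    simp only [hterm, Fintype.sum_sum_type, c.pd_inv_metric_inr_inl hs,
      c.pd_inv_metric_inr_inr hs, c.inv_metric_zeroSec (V.2 hs), Matrix.fromBlocks_apply₂₁,
      Matrix.fromBlocks_apply₂₂, Matrix.zero_apply, zero_mul, zero_add, mul_zero, add_zero,
      Finset.sum_const_zero, hβ]
    have hswap : ∑ β, pd φ β s * -∑ α, (∑ b, (c.frameGram s)⁻¹ a b * c.normalConn b a α s) *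
          (metric c.X s)⁻¹ α β
        = -∑ α, ∑ β, (metric c.X s)⁻¹ α β * pd φ β s *
          ∑ b, (c.frameGram s)⁻¹ a b * c.normalConn b a α s := by
      rw [Finset.sum_comm, ← Finset.sum_neg_distrib]
      refine Finset.sum_congr rfl fun β _ => ?_
      rw [mul_neg, Finset.mul_sum]
      congr 1
      exact Finset.sum_congr rfl fun α _ => by ring
    have hsplit : ∑ b, (c.frameGram s)⁻¹ a b * (pd (pd f.1 (Sum.inr b)) (Sum.inr a) (zeroSec s)
          + 1 / 2 * pd c.logVol (Sum.inr a) (zeroSec s) * pd f.1 (Sum.inr b) (zeroSec s))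
        = ∑ b, (c.frameGram s)⁻¹ a b * pd (pd f.1 (Sum.inr b)) (Sum.inr a) (zeroSec s)
          + 1 / 2 * pd c.logVol (Sum.inr a) (zeroSec s) *
            ∑ b, (c.frameGram s)⁻¹ a b * pd f.1 (Sum.inr b) (zeroSec s) := by
      rw [Finset.mul_sum, ← Finset.sum_add_distrib]
      exact Finset.sum_congr rfl fun b _ => by ring
    rw [hswap, hsplit]
    change _ + _ * (√(metric c.tubeMap (zeroSec s)).det *
      (1 / 2 * pd c.logVol (Sum.inr a) (zeroSec s))) = _
    ring
  -- The term with `∂_α √(det ⟨e_a, e_b⟩)` from `htan` equals the one with `∂_a g_T^{aβ}` from `hnor`.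
  have hcancel : ∑ α, ∑ β, (metric c.X s)⁻¹ α β * pd φ β s *
        ∑ a, ∑ b, (c.frameGram s)⁻¹ a b * c.normalConn b a α s
      = ∑ a, ∑ α, ∑ β, (metric c.X s)⁻¹ α β * pd φ β s *
        ∑ b, (c.frameGram s)⁻¹ a b * c.normalConn b a α s := by
    conv_rhs => rw [Finset.sum_comm]
    refine Finset.sum_congr rfl fun α _ => ?_
    conv_rhs => rw [Finset.sum_comm]
    exact Finset.sum_congr rfl fun β _ => Finset.mul_sum _ _ _
  rw [beltrami, Fintype.sum_sum_type]
  simp only [htan, hnor]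
  rw [← Finset.mul_sum, ← Finset.mul_sum, Finset.sum_add_distrib, Finset.sum_sub_distrib,
    ← Finset.mul_sum, hcancel, hsqrt s hs, beltrami]
  field_simp
  ring_nf

/-- The zero order coefficient of `Δ^∥`. -/
noncomputable def parPotential (s : Fin k → ℝ) : ℝ :=
  -(1 / 4) * ∑ a, ∑ b, c.normalMetricInv s a b *
      ((c.weingarten a s).trace * (c.weingarten b s).trace)
    + 1 / 2 * ∑ a, ∑ b, c.normalMetricInv s a b * (c.weingarten a s * c.weingarten b s).trace

theorem deltaPar_eq (φ : (Fin k → ℝ) → ℝ) (s : Fin k → ℝ) :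
    c.deltaPar φ s = beltrami c.X φ s + c.parPotential s * φ s := rfl

theorem nabla_nabla_zeroSec {V : Set.Iic c.U} (f : AnalyticFn (c.tube V)) {s : Fin k → ℝ}
    (hs : s ∈ V.1) (a b : Fin d) :
    (c.nabla V (Sum.inr a) (c.nabla V (Sum.inr b) f)).1 (zeroSec s)
      = pd (pd f.1 (Sum.inr b)) (Sum.inr a) (zeroSec s)
        + 1 / 2 * (c.weingarten b s).trace * pd f.1 (Sum.inr a) (zeroSec s)
        + 1 / 2 * (c.weingarten a s).trace * pd f.1 (Sum.inr b) (zeroSec s)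
        + (1 / 4 * ((c.weingarten a s).trace * (c.weingarten b s).trace)
          - 1 / 2 * (c.weingarten a s * c.weingarten b s).trace) * f.1 (zeroSec s) := by
  have hu := c.zeroSec_mem hs
  have hw := analyticOnNhd_pd (c.analyticOnNhd_logVol V) (Sum.inr b) _ hu
  have hf := f.analytic _ hu
  rw [c.nabla_apply _ _ hu, c.nabla_apply _ _ hu,
    pd_congr (fun v hv => c.nabla_apply (Sum.inr b) f hv) _ hu,
    pd_fun_add (analyticOnNhd_pd f.analytic _ _ hu) ((analyticAt_const.fun_mul hw).fun_mul hf),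
    pd_mul' (f := fun v => 1 / 4 * pd c.logVol (Sum.inr b) v) (analyticAt_const.fun_mul hw) hf,
    pd_const_mul hw, c.pd_pd_logVol_zeroSec hs, c.pd_logVol_zeroSec hs, c.pd_logVol_zeroSec hs]
  ring

/-- The Beltrami-Laplace operator of `T` on `S` is `Δ^∥ + g_T^{ab} ∇_a ∇_b`. -/
theorem beltrami_tubeMap_eq_deltaPar {V : Set.Iic c.U} (f : AnalyticFn (c.tube V))
    {s : Fin k → ℝ} (hs : s ∈ V.1) :
    beltrami c.tubeMap f.1 (zeroSec s) = c.deltaPar (fun t => f.1 (zeroSec t)) s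
      + ∑ a, ∑ b, (c.frameGram s)⁻¹ a b *
        (c.nabla V (Sum.inr a) (c.nabla V (Sum.inr b) f)).1 (zeroSec s) := by
  have hsymm : ∑ a, ∑ b, (c.frameGram s)⁻¹ a b *
        ((c.weingarten b s).trace * pd f.1 (Sum.inr a) (zeroSec s))
      = ∑ a, ∑ b, (c.frameGram s)⁻¹ a b *
        ((c.weingarten a s).trace * pd f.1 (Sum.inr b) (zeroSec s)) := by
    rw [Finset.sum_comm]
    exact Finset.sum_congr rfl fun a _ => Finset.sum_congr rfl fun b _ => by
      rw [c.symm_frameGram_inv]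
  have hL : ∑ a, ∑ b, (c.frameGram s)⁻¹ a b *
        (pd (pd f.1 (Sum.inr b)) (Sum.inr a) (zeroSec s)
        + 1 / 2 * pd c.logVol (Sum.inr a) (zeroSec s) * pd f.1 (Sum.inr b) (zeroSec s))
      = ∑ a, ∑ b, (c.frameGram s)⁻¹ a b * pd (pd f.1 (Sum.inr b)) (Sum.inr a) (zeroSec s)
        + ∑ a, ∑ b, (c.frameGram s)⁻¹ a b *
          ((c.weingarten a s).trace * pd f.1 (Sum.inr b) (zeroSec s)) := by
    simp only [← Finset.sum_add_distrib]
    exact Finset.sum_congr rfl fun a _ => Finset.sum_congr rfl fun b _ => by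
      rw [c.pd_logVol_zeroSec hs]
      ring
  have hR : ∑ a, ∑ b, (c.frameGram s)⁻¹ a b *
        (c.nabla V (Sum.inr a) (c.nabla V (Sum.inr b) f)).1 (zeroSec s)
      = ∑ a, ∑ b, (c.frameGram s)⁻¹ a b * pd (pd f.1 (Sum.inr b)) (Sum.inr a) (zeroSec s)
        + 1 / 2 * ∑ a, ∑ b, (c.frameGram s)⁻¹ a b *
          ((c.weingarten b s).trace * pd f.1 (Sum.inr a) (zeroSec s))
        + 1 / 2 * ∑ a, ∑ b, (c.frameGram s)⁻¹ a b *
          ((c.weingarten a s).trace * pd f.1 (Sum.inr b) (zeroSec s))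
        - c.parPotential s * f.1 (zeroSec s) := by
    simp only [parPotential, c.normalMetricInv_eq (V.2 hs), add_mul, Finset.mul_sum,
      Finset.sum_mul, ← Finset.sum_add_distrib, ← Finset.sum_sub_distrib]
    exact Finset.sum_congr rfl fun a _ => Finset.sum_congr rfl fun b _ => by
      rw [c.nabla_nabla_zeroSec f hs]
      ring
  rw [c.beltrami_tubeMap_zeroSec f hs, c.deltaPar_eq, hL, hR, hsymm]
  ring

theorem analyticAt_normalMetricInv {s : Fin k → ℝ} (hs : s ∈ c.U) (a b : Fin d) :
    AnalyticAt ℝ (fun t => c.normalMetricInv t a b) s :=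
  (analyticAt_inv_apply (c.analyticAt_frameGram hs) (c.det_frameGram_pos hs).ne' a b).congr <| by
    filter_upwards [c.U.isOpen.mem_nhds hs] with t ht using (c.normalMetricInv_eq ht a b).symm

theorem analyticAt_parPotential {s : Fin k → ℝ} (hs : s ∈ c.U) :
    AnalyticAt ℝ c.parPotential s := by
  have hw := c.analyticAt_weingarten hs
  have hg := c.analyticAt_normalMetricInv hs
  unfold parPotential
  simp only [Matrix.trace, Matrix.diag_apply, Matrix.mul_apply]
  refine (analyticAt_const.fun_mul (Finset.analyticAt_fun_sum _ fun a _ =>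
    Finset.analyticAt_fun_sum _ fun b _ => (hg a b).fun_mul ?_)).fun_add
    (analyticAt_const.fun_mul (Finset.analyticAt_fun_sum _ fun a _ =>
    Finset.analyticAt_fun_sum _ fun b _ => (hg a b).fun_mul ?_))
  · exact (Finset.analyticAt_fun_sum _ fun i _ => hw a i i).fun_mul
      (Finset.analyticAt_fun_sum _ fun i _ => hw b i i)
  · exact Finset.analyticAt_fun_sum _ fun i _ => Finset.analyticAt_fun_sum _ fun j _ =>
      (hw a i j).fun_mul (hw b j i)

/-- `Δ^∥` is a differential operator on `S` with analytic coefficients. -/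
theorem exists_baseOp_deltaPar (V : Set.Iic c.U) :
    ∃ Q ∈ c.baseOps V, ∀ φ : AnalyticFn V.1, ∀ s ∈ V.1, (Q φ).1 s = c.deltaPar φ.1 s := by
  have hg : AnalyticOnNhd ℝ (fun t => √(metric c.X t).det) V.1 := fun s hs =>
    analyticAt_sqrt (analyticAt_det (c.analyticAt_metric_X (V.2 hs))) (c.det_metric_X_pos (V.2 hs))
  have hg' : AnalyticOnNhd ℝ (fun t => (√(metric c.X t).det)⁻¹) V.1 := fun s hs =>
    (hg s hs).inv (Real.sqrt_pos.2 (c.det_metric_X_pos (V.2 hs))).ne'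
  have hm : ∀ α β, AnalyticOnNhd ℝ (fun t => (metric c.X t)⁻¹ α β) V.1 := fun α β s hs =>
    analyticAt_inv_apply (c.analyticAt_metric_X (V.2 hs)) (c.det_metric_X_pos (V.2 hs)).ne' α β
  have hp : AnalyticOnNhd ℝ c.parPotential V.1 := fun s hs =>
    c.analyticAt_parPotential (V.2 hs)
  have hmul : ∀ (a : (Fin k → ℝ) → ℝ) (ha : AnalyticOnNhd ℝ a V.1), mulOp V.1 a ha ∈ c.baseOps V := by
    intro a ha
    have : mulOp V.1 a ha = mulOp V.1 (AnalyticFn.of V.1 a ha).1 (AnalyticFn.of V.1 a ha).2 := by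
      refine LinearMap.ext fun f => AnalyticFn.ext' fun s hs => ?_
      rw [mulOp_apply _ _ hs, mulOp_apply _ _ hs, AnalyticFn.of_apply ha hs]
    rw [this]
    exact Algebra.subset_adjoin (Or.inl ⟨AnalyticFn.of V.1 a ha, rfl⟩)
  have hpd : ∀ α, pdOp V.1 α ∈ c.baseOps V := fun α => Algebra.subset_adjoin (Or.inr ⟨α, rfl⟩)
  have hsum : ∀ (F : Fin k → AnalyticFn V.1) s, (∑ i, F i).1 s = ∑ i, (F i).1 s := by
    intro F s
    let ev : AnalyticFn V.1 →ₗ[ℝ] ℝ :=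
      { toFun := fun g => g.1 s, map_add' := fun _ _ => rfl, map_smul' := fun _ _ => rfl }
    exact map_sum ev _ _
  refine ⟨mulOp V.1 _ hg' * (∑ α, pdOp V.1 α * (mulOp V.1 _ hg *
    ∑ β, mulOp V.1 _ (hm α β) * pdOp V.1 β)) + mulOp V.1 _ hp, ?_, fun φ s hs => ?_⟩
  · exact Subalgebra.add_mem _ (Subalgebra.mul_mem _ (hmul _ hg') (Subalgebra.sum_mem _ fun α _ =>
      Subalgebra.mul_mem _ (hpd α) (Subalgebra.mul_mem _ (hmul _ hg) (Subalgebra.sum_mem _ fun β _ =>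
        Subalgebra.mul_mem _ (hmul _ (hm α β)) (hpd β))))) (hmul _ hp)
  · have h1 : ∀ α, ∀ t ∈ V.1, ((mulOp V.1 _ hg * ∑ β, mulOp V.1 _ (hm α β) * pdOp V.1 β) φ).1 t
        = √(metric c.X t).det * ∑ β, (metric c.X t)⁻¹ α β * pd φ.1 β t := fun α t ht => by
      rw [Module.End.mul_apply, mulOp_apply _ _ ht, LinearMap.sum_apply, hsum]
      congr 1
      refine Finset.sum_congr rfl fun β _ => ?_
      rw [Module.End.mul_apply, mulOp_apply _ _ ht, pdOp_apply _ _ ht]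
    change (mulOp V.1 _ hg' _).1 s + (mulOp V.1 _ hp φ).1 s = _
    rw [mulOp_apply _ _ hs, mulOp_apply _ _ hs, LinearMap.sum_apply, hsum, c.deltaPar_eq, beltrami]
    congr 2
    refine Finset.sum_congr rfl fun α _ => ?_
    rw [Module.End.mul_apply, pdOp_apply _ _ hs, pd_congr (h1 α) α hs]

theorem deltaPar_congr {V : Set.Iic c.U} {φ ψ : (Fin k → ℝ) → ℝ} (h : ∀ s ∈ V.1, φ s = ψ s)
    {s : Fin k → ℝ} (hs : s ∈ V.1) : c.deltaPar φ s = c.deltaPar ψ s := by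
  rw [c.deltaPar_eq, c.deltaPar_eq, h s hs, beltrami, beltrami]
  congr 2
  refine Finset.sum_congr rfl fun α _ => pd_congr (O := V.1) (fun t ht => ?_) α hs
  congr 1
  exact Finset.sum_congr rfl fun β _ => by rw [pd_congr h β ht]

/-- `D` is the operator `Δ^∥` in `i_S^* 𝒟_T`. -/
def IsDeltaPar (V : Set.Iic c.U) (D : c.ops V) : Prop :=
  ∀ f : AnalyticFn (c.tube V), ∀ s ∈ V.1,
    (D.1 f).1 (zeroSec s) = c.deltaPar (c.restrictS V f).1 s

theorem exists_isDeltaPar (V : Set.Iic c.U) : ∃ D : c.ops V, c.IsDeltaPar V D := by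
  obtain ⟨Q, hQ, hQ'⟩ := c.exists_baseOp_deltaPar V
  obtain ⟨P, hP⟩ := c.exists_lift hQ
  exact ⟨P, fun f s hs => by rw [← c.restrictS_apply _ hs, hP, hQ' _ s hs]⟩

/-! ### Solutions of the restricted Schrödinger system -/

/-- `i_S^* Δ_T = Δ^∥ + g_T^{ab}|_S ∇_a ∇_b`; in particular `i_S^* Δ_T` and `Δ^∥` agree modulo the
left ideal generated by the `∇_a`. -/
theorem exists_isRestrictedLaplacian {V : Set.Iic c.U} {D : c.ops V} (hD : c.IsDeltaPar V D) :
    ∃ R : Fin d → c.ops V,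
      c.IsRestrictedLaplacian V (D + ∑ a, R a * c.normalNabla V a) := by
  have hg : ∀ a b, AnalyticOnNhd ℝ (fun s => (c.frameGram s)⁻¹ a b) V.1 := fun a b s hs =>
    analyticAt_inv_apply (c.analyticAt_frameGram (V.2 hs)) (c.det_frameGram_pos (V.2 hs)).ne' a b
  let G : Fin d → Fin d → c.ops V := fun a b =>
    ⟨c.mulBase V (AnalyticFn.of V.1 _ (hg a b)), Algebra.subset_adjoin (Or.inl ⟨_, rfl⟩)⟩
  refine ⟨fun b => ∑ a, G a b * c.normalNabla V a, fun f s hs => ?_⟩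
  let ev : c.ops V →ₗ[ℝ] ℝ :=
    { toFun := fun P => (P.1 f).1 (zeroSec s), map_add' := fun _ _ => rfl,
      map_smul' := fun _ _ => rfl }
  have hG : ∀ a b, ev (G a b * c.normalNabla V a * c.normalNabla V b)
      = (c.frameGram s)⁻¹ a b *
        (c.nabla V (Sum.inr a) (c.nabla V (Sum.inr b) f)).1 (zeroSec s) := fun a b => by
    refine (mulOp_apply (c.analyticOnNhd_base V _) _ (c.zeroSec_mem hs)).trans ?_
    rw [foot_zeroSec, AnalyticFn.of_apply (hg a b) hs]
    rfl
  change ev (D + ∑ b, (∑ a, G a b * c.normalNabla V a) * c.normalNabla V b) = _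
  rw [map_add, map_sum, c.beltrami_tubeMap_eq_deltaPar f hs]
  congr 1
  · exact (hD f s hs).trans (c.deltaPar_congr (fun t ht => c.restrictS_apply f ht) hs)
  · rw [Finset.sum_comm]
    refine Finset.sum_congr rfl fun b _ => ?_
    rw [Finset.sum_mul, map_sum]
    exact Finset.sum_congr rfl fun a _ => hG a b

theorem isRestrictedLaplacian_unique {V : Set.Iic c.U} {Q Q' : c.ops V}
    (hQ : c.IsRestrictedLaplacian V Q) (hQ' : c.IsRestrictedLaplacian V Q') : Q = Q' :=
  c.op_ext fun f s hs => (hQ f s hs).trans (hQ' f s hs).symm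

/-- Modulo the `∇_a`, the operators `i_S^* Δ_T` and `Δ^∥` act in the same way. -/
theorem isRestrictedLaplacian_apply {V : Set.Iic c.U} {D Q : c.ops V} (hD : c.IsDeltaPar V D)
    (hQ : c.IsRestrictedLaplacian V Q) {ψ : AnalyticFn (c.tube V)}
    (hψ : ∀ a : Fin d, c.nabla V (Sum.inr a) ψ = 0) : Q.1 ψ = D.1 ψ := by
  obtain ⟨R, hR⟩ := c.exists_isRestrictedLaplacian hD
  rw [c.isRestrictedLaplacian_unique hQ hR]
  let ev : c.ops V →ₗ[ℝ] AnalyticFn (c.tube V) :=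
    { toFun := fun P => P.1 ψ, map_add' := fun _ _ => rfl, map_smul' := fun _ _ => rfl }
  change ev (D + _) = ev D
  rw [map_add, map_sum, Finset.sum_eq_zero, add_zero]
  intro a _
  change (R a).1 (c.nabla V (Sum.inr a) ψ) = 0
  rw [hψ, map_zero]

theorem deltaPar_op_eq_zero {V : Set.Iic c.U} {D : c.ops V} (hD : c.IsDeltaPar V D)
    {ψ : AnalyticFn (c.tube V)} (hψ : ∀ a : Fin d, c.nabla V (Sum.inr a) ψ = 0)
    (h0 : ∀ s ∈ V.1, c.deltaPar (c.restrictS V ψ).1 s = 0) : D.1 ψ = 0 :=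
  c.eq_zero_of_normalNabla_eq_zero (fun a => by rw [c.nabla_op_apply, hψ, map_zero])
    fun s hs => (hD ψ s hs).trans (h0 s hs)

theorem nabla_restrictFn {W V : Set.Iic c.U} (h : W ≤ V) (μ : Fin k ⊕ Fin d)
    (f : AnalyticFn (c.tube V)) :
    c.nabla W μ (restrictFn (c.tube_mono h) f) = restrictFn (c.tube_mono h) (c.nabla V μ f) := by
  refine AnalyticFn.ext' fun u hu => ?_
  have hr : ∀ (g : AnalyticFn (c.tube V)), ∀ v ∈ c.tube W,
      (restrictFn (c.tube_mono h) g).1 v = g.1 v := fun g v hv => AnalyticFn.of_apply _ hv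
  rw [hr _ u hu, c.nabla_apply μ _ hu, c.nabla_apply μ _ (c.tube_mono h hu), hr _ u hu,
    pd_congr (hr f) μ hu]

theorem cls_normalNabla (V : Set.Iic c.U) (a : Fin d) : c.cls V (c.normalNabla V a) = 0 := by
  refine (Submodule.Quotient.mk_eq_zero _).2
    ⟨Pi.single a (c.restrictedCls V 1), ?_⟩
  rw [eta, LinearMap.sum_apply, Finset.sum_eq_single a]
  · rw [LinearMap.comp_apply, LinearMap.proj_apply, Pi.single_eq_same]
    exact congrArg (c.restrictedCls V) (one_mul _)
  · intro b _ hb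
    rw [LinearMap.comp_apply, LinearMap.proj_apply, Pi.single_eq_of_ne hb, map_zero]
  · simp

theorem cls_eq_zero_of_isRestrictedLaplacian {V : Set.Iic c.U} {Q : c.ops V}
    (hQ : c.IsRestrictedLaplacian V Q) : c.cls V Q = 0 := by
  have h : c.restrictedCls V Q = 0 :=
    (Submodule.Quotient.mk_eq_zero _).2 (Submodule.subset_span hQ)
  exact (congrArg (LinearMap.range (c.eta V)).mkQ h).trans (map_zero _)

/-- A homomorphism from `𝒮^∥` is determined by the function to which it sends the class of `1`. -/
theorem app_cls {W : Set.Iic c.U} (F : c.ParallelSystem W →ₗ[c.ops W] AnalyticFn (c.tube W))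
    (P : c.ops W) : F (c.cls W P) = P.1 (F (c.cls W 1)) := by
  conv_lhs => rw [← mul_one P, ← smul_eq_mul, map_smul, map_smul]
  rfl

theorem cls_surjective (W : Set.Iic c.U) : Function.Surjective (c.cls W) :=
  (Submodule.mkQ_surjective _).comp (Submodule.mkQ_surjective _)

/-- A function that is annihilated by the `∇_a` and by `i_S^* Δ_T` defines a homomorphism from
`𝒮^∥`. -/
theorem exists_hom {W : Set.Iic c.U} {ψ : AnalyticFn (c.tube W)}
    (hψ : ∀ a : Fin d, c.nabla W (Sum.inr a) ψ = 0)
    (hQ : ∀ Q, c.IsRestrictedLaplacian W Q → Q.1 ψ = 0) :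
    ∃ F : c.ParallelSystem W →ₗ[c.ops W] AnalyticFn (c.tube W),
      ∀ P, F (c.cls W P) = P.1 ψ := by
  let L : c.RestrictedSystem W →ₗ[c.ops W] AnalyticFn (c.tube W) :=
    (c.laplaceIdeal W).liftQ (LinearMap.toSpanSingleton (c.ops W) _ ψ)
      (Submodule.span_le.2 fun Q h => hQ Q h)
  have hL : LinearMap.range (c.eta W) ≤ LinearMap.ker L := by
    rintro _ ⟨p, rfl⟩
    rw [LinearMap.mem_ker, eta, LinearMap.sum_apply, map_sum]
    refine Finset.sum_eq_zero fun a _ => ?_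
    obtain ⟨P, hP⟩ := Submodule.mkQ_surjective (c.laplaceIdeal W) (p a)
    rw [LinearMap.comp_apply, LinearMap.proj_apply, ← hP]
    change P.1 (c.nabla W (Sum.inr a) ψ) = 0
    rw [hψ, map_zero]
  exact ⟨(LinearMap.range (c.eta W)).liftQ L hL, fun P => rfl⟩

theorem Solution.ext_toFn {V : Set.Iic c.U} {φ φ' : c.Solution V} (h : φ.toFn = φ'.toFn) :
    φ = φ' := by
  have h1 : ∀ W (hW : W ≤ V), c.Restricts hW 1 1 := fun W hW f => rfl
  have key : φ.app = φ'.app := by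
    funext W hW
    refine LinearMap.ext fun x => ?_
    obtain ⟨P, rfl⟩ := c.cls_surjective W x
    rw [c.app_cls, c.app_cls (φ'.app W hW), φ.compat V W le_rfl hW 1 1 (h1 W hW),
      φ'.compat V W le_rfl hW 1 1 (h1 W hW)]
    exact congrArg (fun f => P.1 (restrictFn (c.tube_mono hW) f)) h
  cases φ
  cases φ'
  cases key
  rfl

theorem bijOn_toFn {V : Set.Iic c.U} {D : c.ops V} (hD : c.IsDeltaPar V D) :
    Set.BijOn (fun φ : c.Solution V => φ.toFn) Set.univ
      {ψ | (∀ a : Fin d, c.nabla V (Sum.inr a) ψ = 0) ∧ D.1 ψ = 0} := by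
  refine ⟨fun φ _ => ?_, fun φ _ φ' _ h => Solution.ext_toFn c h, fun ψ hψ => ?_⟩
  · have hn : ∀ a : Fin d, c.nabla V (Sum.inr a) φ.toFn = 0 := fun a =>
      (c.app_cls (φ.app V le_rfl) (c.normalNabla V a)).symm.trans (by
        rw [c.cls_normalNabla, map_zero])
    refine ⟨hn, ?_⟩
    obtain ⟨R, hR⟩ := c.exists_isRestrictedLaplacian hD
    rw [← c.isRestrictedLaplacian_apply hD hR hn]
    refine (c.app_cls (φ.app V le_rfl) _).symm.trans ?_
    rw [c.cls_eq_zero_of_isRestrictedLaplacian hR, map_zero]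
  · have hn : ∀ W (hW : W ≤ V) (a : Fin d),
        c.nabla W (Sum.inr a) (restrictFn (c.tube_mono hW) ψ) = 0 := fun W hW a => by
      rw [c.nabla_restrictFn hW, hψ.1 a]
      exact AnalyticFn.ext' fun u hu => AnalyticFn.of_apply _ hu
    have hQ : ∀ W (hW : W ≤ V) Q, c.IsRestrictedLaplacian W Q →
        Q.1 (restrictFn (c.tube_mono hW) ψ) = 0 := fun W hW Q hQ => by
      obtain ⟨D', hD'⟩ := c.exists_isDeltaPar W
      rw [c.isRestrictedLaplacian_apply hD' hQ (hn W hW)]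
      refine c.deltaPar_op_eq_zero hD' (hn W hW) fun s hs => ?_
      have h := hD ψ s (hW hs)
      rw [hψ.2] at h
      refine Eq.trans (c.deltaPar_congr (V := W) (fun t ht => ?_) hs) h.symm
      rw [c.restrictS_apply _ ht, c.restrictS_apply _ (hW ht)]
      exact AnalyticFn.of_apply _ (c.zeroSec_mem ht)
    choose F hF using fun W hW => c.exists_hom (hn W hW) (hQ W hW)
    have hres : ∀ {O O' O'' : Opens (Fin k ⊕ Fin d → ℝ)} (h : O' ≤ O) (h' : O'' ≤ O')
        (f : AnalyticFn O), restrictFn h' (restrictFn h f) = restrictFn (h'.trans h) f :=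
      fun h h' f => AnalyticFn.ext' fun u hu => by
        simp only [restrictFn]
        rw [AnalyticFn.of_apply _ hu, AnalyticFn.of_apply _ (h' hu), AnalyticFn.of_apply _ hu]
    refine ⟨⟨F, fun W W' hW h P P' hP => ?_⟩, mem_univ _, ?_⟩
    · rw [hF, hF, ← hP, hres]
    · refine (hF V le_rfl 1).trans ?_
      exact AnalyticFn.ext' fun u hu => AnalyticFn.of_apply ψ.analytic hu

/-- An analytic function `φ` on `S` extends to a function annihilated by the `∇_a`, namely to
`(g_T(s, 0) / g_T(s, q))^{1/4} φ(s)`. -/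
theorem exists_normalNabla_extension {V : Set.Iic c.U} (φ : AnalyticFn V.1) :
    ∃ ψ : AnalyticFn (c.tube V), (∀ a : Fin d, c.nabla V (Sum.inr a) ψ = 0) ∧
      c.restrictS V ψ = φ := by
  let B : (Fin k → ℝ) → ℝ := fun s => Real.exp (1 / 4 * c.logVol (zeroSec s)) * φ.1 s
  have hB : ∀ s ∈ V.1, AnalyticAt ℝ B s := fun s hs =>
    (analyticAt_const.fun_mul (analyticAt_comp_zeroSec
      (c.analyticOnNhd_logVol V _ (c.zeroSec_mem hs)))).rexp.fun_mul (φ.analytic s hs)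
  have hψ : AnalyticOnNhd ℝ (fun u => Real.exp (-(1 / 4 * c.logVol u)) * B (foot u)) (c.tube V) :=
    fun u hu => (analyticAt_const.fun_mul (c.analyticOnNhd_logVol V u hu)).fun_neg.rexp.fun_mul
      (analyticAt_comp_foot (hB _ hu.1))
  refine ⟨AnalyticFn.of (c.tube V) _ hψ, fun a => AnalyticFn.ext' fun u hu => ?_,
    AnalyticFn.ext' fun s hs => ?_⟩
  · have h : ∀ v ∈ c.tube V, Real.exp (1 / 4 * c.logVol v) * (AnalyticFn.of (c.tube V) _ hψ).1 v
        = B (foot v) := fun v hv => by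
      rw [AnalyticFn.of_apply hψ hv, Real.exp_neg, mul_inv_cancel_left₀ (Real.exp_ne_zero _)]
    have h' := c.pd_exp_mul (Sum.inr a) (AnalyticFn.of (c.tube V) _ hψ) hu
    rw [pd_congr h _ hu, pd_comp_foot_inr (hB _ hu.1)] at h'
    exact (mul_eq_zero.1 h'.symm).resolve_left (Real.exp_ne_zero _)
  · rw [c.restrictS_apply _ hs, AnalyticFn.of_apply hψ (c.zeroSec_mem hs), Real.exp_neg,
      foot_zeroSec, inv_mul_cancel_left₀ (Real.exp_ne_zero _)]

theorem bijOn_restrictS {V : Set.Iic c.U} {D : c.ops V} (hD : c.IsDeltaPar V D) :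
    Set.BijOn (c.restrictS V)
      {ψ | (∀ a : Fin d, c.nabla V (Sum.inr a) ψ = 0) ∧ D.1 ψ = 0}
      {φ | ∀ s ∈ V.1, c.deltaPar φ.1 s = 0} := by
  refine ⟨fun ψ hψ s hs => ?_, fun ψ hψ ψ' hψ' h => ?_, fun φ hφ => ?_⟩
  · rw [← hD ψ s hs, hψ.2]
    rfl
  · refine sub_eq_zero.1 (c.eq_zero_of_normalNabla_eq_zero (fun a => ?_) fun s hs => ?_)
    · rw [map_sub, hψ.1, hψ'.1, sub_zero]
    · change ψ.1 (zeroSec s) - ψ'.1 (zeroSec s) = 0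
      rw [← c.restrictS_apply ψ hs, ← c.restrictS_apply ψ' hs, h, sub_self]
  · obtain ⟨ψ, hψ, rfl⟩ := c.exists_normalNabla_extension φ
    exact ⟨ψ, ⟨hψ, c.deltaPar_op_eq_zero hD hψ hφ⟩, rfl⟩

end Chart

end SubSchrodinger

open SubSchrodinger in
theorem lemma4p16 {k d : ℕ} (N : TubularNeighborhood k d) (c : Chart N) (V : Set.Iic c.U) :
    ∃ D : c.ops V,
      (∀ f : AnalyticFn (c.tube V), ∀ s ∈ V.1,
        (D.1 f).1 (Chart.zeroSec s) = c.deltaPar (c.restrictS V f).1 s) ∧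
      (∀ D' : c.ops V, (∀ f : AnalyticFn (c.tube V), ∀ s ∈ V.1,
        (D'.1 f).1 (Chart.zeroSec s) = c.deltaPar (c.restrictS V f).1 s) → D' = D) ∧
      Set.BijOn (fun φ : c.Solution V => φ.toFn) Set.univ
        {ψ | (∀ a : Fin d, c.nabla V (Sum.inr a) ψ = 0) ∧ D.1 ψ = 0} ∧
      Set.BijOn (c.restrictS V)
        {ψ | (∀ a : Fin d, c.nabla V (Sum.inr a) ψ = 0) ∧ D.1 ψ = 0}
        {φ | ∀ s ∈ V.1, c.deltaPar φ.1 s = 0} := by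
  obtain ⟨D, hD⟩ := c.exists_isDeltaPar V
  exact ⟨D, hD, fun D' hD' => c.op_ext fun f s hs => (hD' f s hs).trans (hD f s hs).symm,
    c.bijOn_toFn hD, c.bijOn_restrictS hD⟩
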